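/- **Theorem 3.8.** Let $T>0$, $k\in\mathbb N=\{0,1,2,\dots\}$, $n\in\mathbb N^*=\{1,2,\dots\}$, and let $(\omega_j)_{j\in\mathbb N}$ be a strictly increasing sequence of $[0,+\infty)$ with $\omega_0=0$ having a polynomial asymptotic gap: there exist $\varepsilon>0$, $N_0\in\mathbb N$ and $c>0$ such that $\omega_{j+1}-\omega_j\ge c\,j^{\varepsilon}$ for all $j\ge N_0$. For $j<0$ put $\omega_j:=-\omega_{-j}$. Let $h^{2k}_{\omega,r}(\mathbb N,\mathbb C)$ be the real vector space of all $(d_j)_{j\in\mathbb N}\in\ell^2(\mathbb N,\mathbb C)$ with $d_0\in\mathbb R$ and $$\|d\|_{h^{2k}_\omega}^2:=\sum_{j=0}^{\infty}\bigl|(\delta_{j,0}+\omega_j^{k})d_j\bigr|^2<\infty ,$$ with this norm (here $\omega_0^0=1$). Let $H^k_0((0,T),\mathbb R)$ be the closure of $C_c^\infty((0,T),\mathbb R)$ in the real Sobolev space $H^k((0,T),\mathbb R)$, with its topology, and for $0\le m\le k$ and $u\in H^k_0((0,T),\mathbb R)$ let $\|u\|_{H^m_0(0,T)}:=\bigl(\int_0^T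 u^{(m)}(t)^2\,dt\bigr)^{1/2}$. Then there exist a constant $C>0$ and a continuous ($\mathbb R$-)linear map $$\mathcal L^T_k:\ \mathbb R^n\times h^{2k}_{\omega,r}(\mathbb N,\mathbb C)\longrightarrow H^k_0((0,T),\mathbb R)$$ such that for every $d=\bigl((d_{-q})_{q=1,\dots,n},(d_j)_{j\in\mathbb N}\bigr)\in\mathbb R^n\times h^{2k}_{\omega,r}(\mathbb N,\mathbb C)$ the function $u:=\mathcal L^T_k(d)$ satisfies $$\int_0^T u(t)e^{i\omega_jt}\,dt=d_j\quad\text{for all } j\in\mathbb N,\qquad \int_0^T t^q u(t)\,dt=d_{-q}\quad\text{for all } q=1,\dots,n,$$ and $$\|u\|_{H^m_0(0,T)}\le C\Bigl(\sum_{j=-n}^{+\infty}\bigl|(\delta_{j,0}+\omega_j^{m})d_j\bigr|^2\Bigr)^{1/2}\quad\text{for all } m=0,\dots,k .$$ -/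

import Mathlib

open MeasureTheory Set
open scoped ENNReal

noncomputable section

namespace TrigMoment

/-! ### Frequencies and sequence spaces -/

/-- Polynomial asymptotic gap: there are `ε > 0`, `N₀` and `c > 0` with
`ω (j+1) - ω j ≥ c * j ^ ε` for all `j ≥ N₀`. -/
def AsymptGapPoly (ω : ℕ → ℝ) : Prop :=
  ∃ ε : ℝ, 0 < ε ∧ ∃ N₀ : ℕ, ∃ c : ℝ, 0 < c ∧
    ∀ j : ℕ, N₀ ≤ j → c * (j : ℝ) ^ ε ≤ ω (j + 1) - ω j

/-- The extension of the frequencies to `ℤ` by `ω_j = - ω_{-j}` for `j < 0`. -/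
def freq (ω : ℕ → ℝ) (j : ℤ) : ℝ :=
  if 0 ≤ j then ω j.toNat else - ω (-j).toNat

/-- The weight `δ_{j,0} + ω_j ^ m`, for `j ∈ ℤ`. -/
def weight (ω : ℕ → ℝ) (m : ℕ) (j : ℤ) : ℝ :=
  (if j = 0 then 1 else 0) + freq ω j ^ m

/-- The weighted sequence `((δ_{j,0} + ω_j ^ m) d_j)_{j ∈ ℕ}`. -/
def weighted (ω : ℕ → ℝ) (m : ℕ) (d : ℕ → ℂ) : ℕ → ℂ :=
  fun j => ((weight ω m (j : ℤ) : ℝ) : ℂ) * d j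

theorem weighted_add (ω : ℕ → ℝ) (m : ℕ) (d e : ℕ → ℂ) :
    weighted ω m (d + e) = weighted ω m d + weighted ω m e := by
  funext j; simp [weighted, mul_add]

theorem weighted_smul (ω : ℕ → ℝ) (m : ℕ) (c : ℝ) (d : ℕ → ℂ) :
    weighted ω m (c • d) = c • weighted ω m d := by
  funext j; simp [weighted]; ring

theorem weighted_zero (ω : ℕ → ℝ) (m : ℕ) : weighted ω m 0 = 0 := by
  funext j; simp [weighted]

/-- The real vector space underlying `h^{2m}_{ω,r}(ℕ, ℂ)`: the sequences `d ∈ ℓ²(ℕ, ℂ)` with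
`d 0` real and `∑ |(δ_{j,0} + ω_j ^ m) d_j|² < ∞`. -/
def hSubmodule (ω : ℕ → ℝ) (m : ℕ) : Submodule ℝ (ℕ → ℂ) where
  carrier := {d | Memℓp d 2 ∧ (d 0).im = 0 ∧ Memℓp (weighted ω m d) 2}
  add_mem' := by
    rintro d e ⟨h1, h2, h3⟩ ⟨g1, g2, g3⟩
    refine ⟨h1.add g1, by simp [h2, g2], ?_⟩
    rw [weighted_add]
    exact h3.add g3
  zero_mem' := by
    refine ⟨zero_memℓp, by simp, ?_⟩
    rw [weighted_zero]
    exact zero_memℓp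
  smul_mem' := by
    rintro c d ⟨h1, h2, h3⟩
    refine ⟨h1.const_smul c, by simp [h2], ?_⟩
    rw [weighted_smul]
    exact h3.const_smul c

/-- The space `h^{2m}_{ω,r}(ℕ, ℂ)`. It is a type of its own, because it does not carry the topology
of pointwise convergence, but that of the norm below. -/
def HSeq (ω : ℕ → ℝ) (m : ℕ) : Type := hSubmodule ω m

instance (ω : ℕ → ℝ) (m : ℕ) : AddCommGroup (HSeq ω m) :=
  inferInstanceAs (AddCommGroup (hSubmodule ω m))

instance (ω : ℕ → ℝ) (m : ℕ) : Module ℝ (HSeq ω m) :=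
  inferInstanceAs (Module ℝ (hSubmodule ω m))

/-- The terms `d j` of an element `d` of `h^{2m}_{ω,r}(ℕ, ℂ)`. -/
def HSeq.term {ω : ℕ → ℝ} {m : ℕ} (d : HSeq ω m) : ℕ → ℂ := d.1

/-- The linear map `d ↦ ((δ_{j,0} + ω_j ^ m) d_j)_j` from `h^{2m}_{ω,r}` to `ℓ²(ℕ, ℂ)`. -/
def HSeq.toLp (ω : ℕ → ℝ) (m : ℕ) : HSeq ω m →ₗ[ℝ] lp (fun _ : ℕ => ℂ) 2 where
  toFun d := ⟨weighted ω m d.term, d.2.2.2⟩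
  map_add' d e := Subtype.ext (weighted_add ω m d.1 e.1)
  map_smul' c d := Subtype.ext (weighted_smul ω m c d.1)

/-- `‖d‖ = (∑ |(δ_{j,0} + ω_j ^ m) d_j|²)^{1/2}`. (This separates points as soon as `ω j ≠ 0` for
all `j ≥ 1`.) -/
instance (ω : ℕ → ℝ) (m : ℕ) : SeminormedAddCommGroup (HSeq ω m) :=
  SeminormedAddCommGroup.induced (HSeq ω m) (lp (fun _ : ℕ => ℂ) 2) (HSeq.toLp ω m)

instance (ω : ℕ → ℝ) (m : ℕ) : NormedSpace ℝ (HSeq ω m) :=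
  NormedSpace.induced ℝ (HSeq ω m) (lp (fun _ : ℕ => ℂ) 2) (HSeq.toLp ω m)

/-- For data `a = (d_{-q})_{q = 1, …, n}` (stored as `a i = d_{-(i+1)}`) and `d = (d_j)_{j ∈ ℕ}`,
the quantity `(∑_{j ≥ -n} |(δ_{j,0} + ω_j ^ m) d_j|²)^{1/2}`. -/
def dataNorm (ω : ℕ → ℝ) (m : ℕ) {n : ℕ} (a : EuclideanSpace ℝ (Fin n)) (d : ℕ → ℂ) : ℝ :=
  Real.sqrt (∑ i : Fin n, |weight ω m (-(((i : ℕ) : ℤ) + 1)) * a i| ^ 2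
    + ∑' j : ℕ, ‖weighted ω m d j‖ ^ 2)

/-! ### Sobolev spaces on `(0, T)` -/

/-- `L²((0,T), ℝ)`. -/
abbrev L2 (T : ℝ) : Type := Lp ℝ 2 (volume.restrict (Ioo (0 : ℝ) T))

/-- `φ ∈ C_c^∞((0,T), ℝ)`. -/
structure IsTest (T : ℝ) (φ : ℝ → ℝ) : Prop where
  smooth : ContDiff ℝ ((⊤ : ℕ∞) : WithTop ℕ∞) φ
  compact : HasCompactSupport φ
  support : tsupport φ ⊆ Ioo 0 T

/-- `v` is the `m`-th weak derivative of `u` on `(0,T)`. -/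
def IsWeakDeriv (T : ℝ) (m : ℕ) (u v : L2 T) : Prop :=
  ∀ φ : ℝ → ℝ, IsTest T φ →
    ∫ t in Ioo 0 T, u t * iteratedDeriv m φ t = (-1) ^ m * ∫ t in Ioo 0 T, v t * φ t

theorem continuous_iteratedDeriv_test {T : ℝ} {φ : ℝ → ℝ} (hφ : IsTest T φ) (m : ℕ) :
    Continuous (iteratedDeriv m φ) :=
  hφ.smooth.continuous_iteratedDeriv m (by exact_mod_cast le_top)

theorem hasCompactSupport_iteratedDeriv {φ : ℝ → ℝ} (hφ : HasCompactSupport φ) (m : ℕ) :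
    HasCompactSupport (iteratedDeriv m φ) := by
  induction m with
  | zero => simpa using hφ
  | succ m ih => rw [iteratedDeriv_succ]; exact ih.deriv

theorem integrable_mul_test {T : ℝ} (u : L2 T) {φ : ℝ → ℝ} (hφ : IsTest T φ) (m : ℕ) :
    Integrable (fun t => u t * iteratedDeriv m φ t) (volume.restrict (Ioo 0 T)) :=
  MemLp.integrable_mul (p := 2) (q := 2) (Lp.memLp u)
    ((continuous_iteratedDeriv_test hφ m).memLp_of_hasCompactSupport
      (hasCompactSupport_iteratedDeriv hφ.compact m))

theorem integral_add_mul_test {T : ℝ} (u v : L2 T) {φ : ℝ → ℝ} (hφ : IsTest T φ) (m : ℕ) :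
    ∫ t in Ioo 0 T, (u + v : L2 T) t * iteratedDeriv m φ t
      = (∫ t in Ioo 0 T, u t * iteratedDeriv m φ t)
        + ∫ t in Ioo 0 T, v t * iteratedDeriv m φ t := by
  rw [← integral_add (integrable_mul_test u hφ m) (integrable_mul_test v hφ m)]
  refine integral_congr_ae ?_
  filter_upwards [Lp.coeFn_add u v] with t ht
  rw [ht, Pi.add_apply, add_mul]

theorem integral_smul_mul_test {T : ℝ} (c : ℝ) (u : L2 T) (ψ : ℝ → ℝ) :
    ∫ t in Ioo 0 T, (c • u : L2 T) t * ψ t = c * ∫ t in Ioo 0 T, u t * ψ t := by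
  rw [← integral_const_mul]
  refine integral_congr_ae ?_
  filter_upwards [Lp.coeFn_smul c u] with t ht
  rw [ht, Pi.smul_apply, smul_eq_mul, mul_assoc]

theorem integral_zero_mul_test {T : ℝ} (ψ : ℝ → ℝ) :
    ∫ t in Ioo 0 T, (0 : L2 T) t * ψ t = 0 := by
  simpa using integral_smul_mul_test (T := T) 0 0 ψ

/-- The Sobolev space `H^k((0,T), ℝ)`, an element being stored as the tuple `(u, u', …, u^{(k)})` of
a function `u ∈ L²(0,T)` and its weak derivatives, which are in `L²(0,T)` and are determined by `u`.
The norm is the usual one, `(∑_{m ≤ k} ‖u^{(m)}‖²_{L²})^{1/2}`. -/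
def sobolev (T : ℝ) (k : ℕ) : Submodule ℝ (PiLp 2 (fun _ : Fin (k + 1) => L2 T)) where
  carrier := {U | ∀ m : Fin (k + 1), IsWeakDeriv T m (U 0) (U m)}
  add_mem' := by
    intro U V hU hV m φ hφ
    have h0 := integral_add_mul_test (U m) (V m) hφ 0
    simp only [iteratedDeriv_zero] at h0
    simp only [PiLp.add_apply]
    rw [h0, integral_add_mul_test (U 0) (V 0) hφ, hU m φ hφ, hV m φ hφ, mul_add]
  zero_mem' := by
    intro m φ _
    simp only [PiLp.zero_apply]
    rw [integral_zero_mul_test, integral_zero_mul_test, mul_zero]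
  smul_mem' := by
    intro c U hU m φ hφ
    simp only [PiLp.smul_apply]
    rw [integral_smul_mul_test, integral_smul_mul_test, hU m φ hφ]
    ring

/-- The subspace `C_c^∞(0,T)` of `H^k(0,T)`. -/
def testSubmodule (T : ℝ) (k : ℕ) : Submodule ℝ (sobolev T k) where
  carrier := {U | ∃ φ : ℝ → ℝ, IsTest T φ ∧ U.1 0 =ᵐ[volume.restrict (Ioo 0 T)] φ}
  add_mem' := by
    rintro U V ⟨φ, hφ, hU⟩ ⟨ψ, hψ, hV⟩
    refine ⟨φ + ψ, ⟨hφ.smooth.add hψ.smooth, hφ.compact.add hψ.compact,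
      (tsupport_add φ ψ).trans (union_subset hφ.support hψ.support)⟩, ?_⟩
    exact (Lp.coeFn_add (U.1 0) (V.1 0)).trans (hU.add hV)
  zero_mem' := by
    refine ⟨0, ⟨contDiff_const, HasCompactSupport.zero, by simp⟩, ?_⟩
    exact Lp.coeFn_zero ℝ 2 _
  smul_mem' := by
    rintro c U ⟨φ, hφ, hU⟩
    refine ⟨c • φ, ⟨hφ.smooth.const_smul c, hφ.compact.smul_left (f := fun _ => c),
      (tsupport_smul_subset_right (fun _ => c) φ).trans hφ.support⟩, ?_⟩
    exact (Lp.coeFn_smul c (U.1 0)).trans (hU.const_smul c)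

/-- `H^k_0((0,T), ℝ)`, the closure of `C_c^∞(0,T)` in `H^k(0,T)`, with the topology of
`H^k(0,T)`. -/
def sobolevZero (T : ℝ) (k : ℕ) : Submodule ℝ (sobolev T k) :=
  (testSubmodule T k).topologicalClosure

/-- The `m`-th weak derivative `u^{(m)} ∈ L²(0,T)` of `u ∈ H^k_0(0,T)`, for `0 ≤ m ≤ k`. -/
def wderiv {T : ℝ} {k : ℕ} (u : sobolevZero T k) (m : Fin (k + 1)) : L2 T := u.1.1 m

/-- The function `u ∈ L²(0,T)` underlying an element of `H^k_0(0,T)`. -/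
def toFn {T : ℝ} {k : ℕ} (u : sobolevZero T k) : L2 T := wderiv u 0

/-- `‖u‖_{H^m_0(0,T)} = (∫₀ᵀ u^{(m)}(t)² dt)^{1/2}`, for `u ∈ H^k_0(0,T)` and `0 ≤ m ≤ k`. -/
def normZero {T : ℝ} {k : ℕ} (m : Fin (k + 1)) (u : sobolevZero T k) : ℝ :=
  Real.sqrt (∫ t in Ioo 0 T, wderiv u m t ^ 2)

end TrigMoment

end

/-!
For a bump `ρ` on `(0,T)` with `∫ ρ = 1`, the moment of `ρ(t) e^{-ixt}` against `e^{iyt}` is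
`ρ̂(y - x)`, where `ρ̂` is rapidly decreasing. For frequencies `x_j`, `j ∈ ℤ`, with large gaps, the
matrix `ρ̂(x_l - x_j)` is therefore a small perturbation of the identity, by the Schur test, and it
stays so when conjugated by the weights `⟨x_j⟩ᵐ`. Superposing the waves `ρ(t) e^{-i x_j t}` thus
solves the moment problem at high frequencies, with estimates in all the norms `H^m_0` at once. For
real solutions one takes the family `(x_j)` odd.

The finitely many remaining moments, against `e^{iω_j t}` for `j ≤ N` and against the powers of `t`,
are corrected by test functions whose Fourier transform vanishes at all high frequencies. Such
functions are obtained by convolving a solution of the moment problem on `(0,T/2)` with a modulated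
bump; a derivative `(d/dt + iν)` creates a further zero at `ν`, and repeated derivatives kill the
first moments against the powers of `t`.
-/

noncomputable section

open TopologicalSpace Filter
open scoped Distributions Topology Convolution Pointwise

namespace TrigMoment

/-! ### Test functions and their moments -/

section TestFunctions

variable {Ω : Opens ℝ}

/-- Differentiation of test functions, as a linear endomorphism. -/
def testDeriv (𝕜 : Type*) [RCLike 𝕜] (Ω : Opens ℝ) : Module.End 𝕜 𝓓(Ω, 𝕜) :=
  (TestFunction.lineDerivCLM 𝕜 (1 : ℝ)).toLinearMap

theorem testDeriv_apply {𝕜 : Type*} [RCLike 𝕜] (φ : 𝓓(Ω, 𝕜)) (t : ℝ) :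
    testDeriv 𝕜 Ω φ t = deriv φ t := by
  simp [testDeriv, lineDeriv, deriv_comp_const_add]

theorem coe_testDeriv_pow {𝕜 : Type*} [RCLike 𝕜] (m : ℕ) (φ : 𝓓(Ω, 𝕜)) :
    ⇑((testDeriv 𝕜 Ω ^ m) φ) = iteratedDeriv m φ := by
  induction m with
  | zero => simp
  | succ m ih =>
    rw [pow_succ', iteratedDeriv_succ, ← ih]
    exact funext fun t => testDeriv_apply _ t

/-- The real part of a complex test function. -/
def reTest (Ω : Opens ℝ) : 𝓓(Ω, ℂ) →ₗ[ℝ] 𝓓(Ω, ℝ) :=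
  (TestFunction.postcompCLM Complex.reCLM).toLinearMap

theorem reTest_apply (h : 𝓓(Ω, ℂ)) (t : ℝ) : reTest Ω h t = (h t).re := rfl

theorem hasDerivAt_testDeriv {𝕜 : Type*} [RCLike 𝕜] (φ : 𝓓(Ω, 𝕜)) (t : ℝ) :
    HasDerivAt φ (testDeriv 𝕜 Ω φ t) t := by
  rw [testDeriv_apply]
  exact (φ.contDiff.differentiable (by simp) t).hasDerivAt

theorem testDeriv_reTest (h : 𝓓(Ω, ℂ)) :
    testDeriv ℝ Ω (reTest Ω h) = reTest Ω (testDeriv ℂ Ω h) := by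
  ext t
  exact (hasDerivAt_testDeriv (reTest Ω h) t).unique
    (Complex.reCLM.hasFDerivAt.comp_hasDerivAt t (hasDerivAt_testDeriv h t))

theorem testDeriv_pow_reTest (m : ℕ) (h : 𝓓(Ω, ℂ)) :
    (testDeriv ℝ Ω ^ m) (reTest Ω h) = reTest Ω ((testDeriv ℂ Ω ^ m) h) := by
  induction m with
  | zero => simp
  | succ m ih => simp only [pow_succ', Module.End.mul_apply, ih, testDeriv_reTest]

theorem integrable_test_mul (h : 𝓓(Ω, ℂ)) {ψ : ℝ → ℂ} (hψ : Continuous ψ) :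
    Integrable fun t => h t * ψ t :=
  (h.continuous.mul hψ).integrable_of_hasCompactSupport h.hasCompactSupport.mul_right

/-- The functional `h ↦ ∫ h ψ` on test functions. -/
def testMoment (Ω : Opens ℝ) (ψ : C(ℝ, ℂ)) : 𝓓(Ω, ℂ) →ₗ[ℂ] ℂ where
  toFun h := ∫ t, h t * ψ t
  map_add' h g := by
    simp only [add_apply, add_mul]
    exact integral_add (integrable_test_mul h ψ.continuous) (integrable_test_mul g ψ.continuous)
  map_smul' c h := by
    simp only [smul_apply, smul_eq_mul, mul_assoc, integral_const_mul, RingHom.id_apply]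

theorem testMoment_apply (ψ : C(ℝ, ℂ)) (h : 𝓓(Ω, ℂ)) : testMoment Ω ψ h = ∫ t, h t * ψ t := rfl

theorem testMoment_testDeriv {ψ ψ' : C(ℝ, ℂ)} (hψ : ∀ t, HasDerivAt ψ (ψ' t) t) (h : 𝓓(Ω, ℂ)) :
    testMoment Ω ψ (testDeriv ℂ Ω h) = -testMoment Ω ψ' h := by
  simp only [testMoment_apply]
  rw [integral_mul_deriv_eq_deriv_mul_of_integrable (fun t _ => hasDerivAt_testDeriv h t)
    (fun t _ => hψ t) (integrable_test_mul h ψ'.continuous)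
    (integrable_test_mul _ ψ.continuous) (integrable_test_mul h ψ.continuous), neg_neg]

/-- The exponential `t ↦ e^{ixt}`. -/
def expMap (x : ℝ) : C(ℝ, ℂ) where
  toFun t := Complex.exp (Complex.I * x * t)

/-- The power `t ↦ t ^ p`. -/
def powMap (p : ℕ) : C(ℝ, ℂ) where
  toFun t := (t : ℂ) ^ p

theorem expMap_apply (x t : ℝ) : expMap x t = Complex.exp (Complex.I * x * t) := rfl

theorem powMap_apply (p : ℕ) (t : ℝ) : powMap p t = (t : ℂ) ^ p := rfl

theorem expMap_add (x y : ℝ) : expMap (x + y) = expMap x * expMap y := by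
  ext t
  rw [ContinuousMap.mul_apply, expMap_apply, expMap_apply, expMap_apply, ← Complex.exp_add,
    Complex.ofReal_add, mul_add, add_mul]

theorem star_expMap (x : ℝ) : star (expMap x) = expMap (-x) := by
  ext t
  simp [expMap_apply, ← Complex.exp_conj]

theorem star_powMap (p : ℕ) : star (powMap p) = powMap p := by
  ext t
  simp [powMap_apply]

theorem expMap_zero : expMap 0 = powMap 0 := by
  ext t
  simp [expMap_apply, powMap_apply]

theorem norm_expMap (x t : ℝ) : ‖expMap x t‖ = 1 := by
  rw [expMap_apply, show Complex.I * x * t = ((x * t : ℝ) : ℂ) * Complex.I by push_cast; ring,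
    Complex.norm_exp_ofReal_mul_I]

theorem hasDerivAt_expMap (x t : ℝ) :
    HasDerivAt (expMap x) (((Complex.I * x) • expMap x) t) t := by
  have h := (Complex.ofRealCLM.hasDerivAt.const_mul (Complex.I * x) (x := t)).cexp
  exact h.congr_deriv (by simp [expMap_apply, mul_comm])

theorem hasDerivAt_powMap (p : ℕ) (t : ℝ) :
    HasDerivAt (powMap p) (((p : ℂ) • powMap (p - 1)) t) t := by
  have h := (Complex.ofRealCLM.hasDerivAt (x := t)).pow p
  exact h.congr_deriv (by simp [powMap_apply])

theorem contDiff_expMap {n : WithTop ℕ∞} (x : ℝ) : ContDiff ℝ n (expMap x) :=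
  (contDiff_const.mul Complex.ofRealCLM.contDiff).cexp

/-- The Fourier transform `x ↦ ∫ h(t) e^{ixt} dt` of a test function. -/
def ft (h : 𝓓(Ω, ℂ)) (x : ℝ) : ℂ := testMoment Ω (expMap x) h

theorem testMoment_smul (c : ℂ) (ψ : C(ℝ, ℂ)) (h : 𝓓(Ω, ℂ)) :
    testMoment Ω (c • ψ) h = c * testMoment Ω ψ h := by
  simp only [testMoment_apply, ContinuousMap.smul_apply, smul_eq_mul, ← integral_const_mul,
    mul_left_comm]

theorem ft_testDeriv (h : 𝓓(Ω, ℂ)) (x : ℝ) :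
    ft (testDeriv ℂ Ω h) x = -(Complex.I * x) * ft h x := by
  rw [ft, testMoment_testDeriv (hasDerivAt_expMap x), testMoment_smul, neg_mul, ft]

theorem ft_testDeriv_pow (r : ℕ) (h : 𝓓(Ω, ℂ)) (x : ℝ) :
    ft ((testDeriv ℂ Ω ^ r) h) x = (-(Complex.I * x)) ^ r * ft h x := by
  induction r with
  | zero => simp
  | succ r ih => rw [pow_succ', Module.End.mul_apply, ft_testDeriv, ih, pow_succ', mul_assoc]

theorem testMoment_powMap_testDeriv_pow (p q : ℕ) (h : 𝓓(Ω, ℂ)) :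
    testMoment Ω (powMap p) ((testDeriv ℂ Ω ^ q) h)
      = (-1) ^ q * p.descFactorial q * testMoment Ω (powMap (p - q)) h := by
  induction q generalizing h with
  | zero => simp
  | succ q ih =>
    rw [pow_succ, Module.End.mul_apply, ih, testMoment_testDeriv (hasDerivAt_powMap _),
      testMoment_smul, Nat.descFactorial_succ, Nat.sub_sub]
    push_cast
    ring

theorem norm_ft_le (h : 𝓓(Ω, ℂ)) (x : ℝ) : ‖ft h x‖ ≤ ∫ t, ‖h t‖ := by
  refine (norm_integral_le_integral_norm _).trans_eq ?_
  simp only [norm_mul, norm_expMap, mul_one]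

theorem exists_ft_decay (h : 𝓓(Ω, ℂ)) (r : ℕ) :
    ∃ A : ℝ, 0 ≤ A ∧ ∀ x : ℝ, (1 + |x|) ^ r * ‖ft h x‖ ≤ A := by
  have hpow (x : ℝ) : |x| ^ r * ‖ft h x‖ ≤ ∫ t, ‖(testDeriv ℂ Ω ^ r) h t‖ := by
    simpa [ft_testDeriv_pow] using norm_ft_le ((testDeriv ℂ Ω ^ r) h) x
  refine ⟨2 ^ (r - 1) * ((∫ t, ‖h t‖) + ∫ t, ‖(testDeriv ℂ Ω ^ r) h t‖), by positivity,
    fun x => ?_⟩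
  calc (1 + |x|) ^ r * ‖ft h x‖ ≤ (2 ^ (r - 1) * (1 ^ r + |x| ^ r)) * ‖ft h x‖ := by
        gcongr
        exact add_pow_le zero_le_one (abs_nonneg x) r
    _ = 2 ^ (r - 1) * (‖ft h x‖ + |x| ^ r * ‖ft h x‖) := by ring
    _ ≤ _ := by gcongr; exacts [norm_ft_le h x, hpow x]

/-- The product `ρ(t) e^{-ixt}`, whose Fourier transform is that of `ρ` translated by `x`. -/
def modulate (ρ : 𝓓(Ω, ℂ)) (x : ℝ) : 𝓓(Ω, ℂ) where
  toFun t := ρ t * expMap (-x) t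
  contDiff' := ρ.contDiff.mul (contDiff_expMap _)
  hasCompactSupport' := ρ.hasCompactSupport.mul_right
  tsupport_subset' := tsupport_mul_subset_left.trans ρ.tsupport_subset

theorem modulate_apply (ρ : 𝓓(Ω, ℂ)) (x t : ℝ) : modulate ρ x t = ρ t * expMap (-x) t := rfl

theorem ft_modulate (ρ : 𝓓(Ω, ℂ)) (x y : ℝ) : ft (modulate ρ x) y = ft ρ (y - x) := by
  refine integral_congr_ae (ae_of_all _ fun t => ?_)
  simp only [modulate_apply]
  rw [sub_eq_neg_add, expMap_add, ContinuousMap.mul_apply, mul_assoc]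

theorem testDeriv_modulate (ρ : 𝓓(Ω, ℂ)) (x : ℝ) :
    testDeriv ℂ Ω (modulate ρ x)
      = modulate (testDeriv ℂ Ω ρ) x - (Complex.I * x) • modulate ρ x := by
  ext t
  refine (hasDerivAt_testDeriv _ t).unique
    (((hasDerivAt_testDeriv ρ t).mul (hasDerivAt_expMap (-x) t)).congr_deriv ?_)
  simp only [modulate_apply, sub_apply, smul_apply, ContinuousMap.smul_apply, smul_eq_mul,
    Complex.ofReal_neg]
  ring

/-- The squared modulus of a test function. -/
def normSqTest (ρ : 𝓓(Ω, ℂ)) : 𝓓(Ω, ℂ) where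
  toFun t := star (ρ t) * ρ t
  contDiff' := (Complex.conjCLE.contDiff.comp ρ.contDiff).mul ρ.contDiff
  hasCompactSupport' := ρ.hasCompactSupport.mul_left
  tsupport_subset' := tsupport_mul_subset_right.trans ρ.tsupport_subset

end TestFunctions

/-! ### Test functions and moments in `H^k_0(0,T)` -/

section Sobolev

/-- The interval `(0,T)`. -/
def interval (T : ℝ) : Opens ℝ := ⟨Ioo 0 T, isOpen_Ioo⟩

variable {𝕜 : Type*} [RCLike 𝕜] {T : ℝ} {k : ℕ}

theorem setIntegral_test_mul {E : Type*} [NormedAddCommGroup E] [NormedSpace ℝ E]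
    (φ : 𝓓(interval T, 𝕜)) {f : ℝ → E} (hf : ∀ t, φ t = 0 → f t = 0) :
    ∫ t in Ioo 0 T, f t = ∫ t, f t :=
  setIntegral_eq_integral_of_forall_compl_eq_zero fun t ht => hf t <| by
    by_contra h
    exact ht (φ.tsupport_subset (subset_tsupport _ h))

/-- The class of a test function in `L²(0,T)`. -/
def testL2 (𝕜 : Type*) [RCLike 𝕜] (T : ℝ) :
    𝓓(interval T, 𝕜) →ₗ[𝕜] Lp 𝕜 2 (volume.restrict (Ioo 0 T)) :=
  (BoundedContinuousFunction.toLp 2 _ 𝕜).toLinearMap ∘ₗ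
    (TestFunction.toBoundedContinuousFunctionCLM 𝕜).toLinearMap

theorem coeFn_testL2 (φ : 𝓓(interval T, 𝕜)) :
    testL2 𝕜 T φ =ᵐ[volume.restrict (Ioo 0 T)] φ :=
  BoundedContinuousFunction.coeFn_toLp _ _ 𝕜
    (TestFunction.toBoundedContinuousFunctionCLM 𝕜 φ)

theorem inner_testL2_left (φ : 𝓓(interval T, 𝕜)) (u : Lp 𝕜 2 (volume.restrict (Ioo 0 T))) :
    inner 𝕜 (testL2 𝕜 T φ) u = ∫ t in Ioo 0 T, u t * star (φ t) := by
  rw [L2.inner_def]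
  refine integral_congr_ae ?_
  filter_upwards [coeFn_testL2 φ] with t ht
  rw [ht]
  rfl

theorem inner_testL2_testL2 (φ ψ : 𝓓(interval T, 𝕜)) :
    inner 𝕜 (testL2 𝕜 T φ) (testL2 𝕜 T ψ) = ∫ t, ψ t * star (φ t) := by
  rw [inner_testL2_left, ← setIntegral_test_mul ψ fun t ht => by rw [ht, zero_mul]]
  refine integral_congr_ae ?_
  filter_upwards [coeFn_testL2 ψ] with t ht
  rw [ht]

theorem norm_testL2_reTest_le (h : 𝓓(interval T, ℂ)) :
    ‖testL2 ℝ T (reTest _ h)‖ ≤ ‖testL2 ℂ T h‖ := by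
  refine Lp.norm_le_norm_of_ae_le ?_
  filter_upwards [coeFn_testL2 h, coeFn_testL2 (reTest _ h)] with t ht ht'
  rw [ht, ht', reTest_apply]
  exact Complex.abs_re_le_norm _

theorem isTest_coe (φ : 𝓓(interval T, ℝ)) : IsTest T φ :=
  ⟨φ.contDiff, φ.hasCompactSupport, φ.tsupport_subset⟩

theorem isWeakDeriv_iff {m : ℕ} {u v : L2 T} :
    IsWeakDeriv T m u v ↔ ∀ φ : 𝓓(interval T, ℝ),
      inner ℝ (testL2 ℝ T ((testDeriv ℝ _ ^ m) φ)) u = (-1) ^ m * inner ℝ (testL2 ℝ T φ) v := by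
  simp only [inner_testL2_left, coe_testDeriv_pow, star_trivial]
  exact ⟨fun h φ => h φ (isTest_coe φ), fun h φ hφ => h ⟨φ, hφ.1, hφ.2, hφ.3⟩⟩

theorem inner_testL2_testDeriv (φ ψ : 𝓓(interval T, ℝ)) :
    inner ℝ (testL2 ℝ T (testDeriv ℝ _ φ)) (testL2 ℝ T ψ)
      = -inner ℝ (testL2 ℝ T φ) (testL2 ℝ T (testDeriv ℝ _ ψ)) := by
  have hint (φ ψ : 𝓓(interval T, ℝ)) : Integrable fun t => ψ t * φ t :=
    (ψ.continuous.mul φ.continuous).integrable_of_hasCompactSupport ψ.hasCompactSupport.mul_right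
  simp only [inner_testL2_testL2, star_trivial]
  exact integral_mul_deriv_eq_deriv_mul_of_integrable (fun t _ => hasDerivAt_testDeriv ψ t)
    (fun t _ => hasDerivAt_testDeriv φ t) (hint _ _) (hint _ _) (hint _ _)

theorem isWeakDeriv_testL2 (m : ℕ) (φ : 𝓓(interval T, ℝ)) :
    IsWeakDeriv T m (testL2 ℝ T φ) (testL2 ℝ T ((testDeriv ℝ _ ^ m) φ)) := by
  refine isWeakDeriv_iff.2 fun ψ => ?_
  induction m generalizing φ with
  | zero => simp
  | succ m ih =>
    rw [pow_succ', Module.End.mul_apply, inner_testL2_testDeriv, ih, ← Module.End.mul_apply,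
      ← pow_succ, ← pow_succ', pow_succ (-1), mul_neg_one, neg_mul]

/-- The inclusion of the test functions in `H^k_0(0,T)`. -/
def embed (T : ℝ) (k : ℕ) : 𝓓(interval T, ℝ) →ₗ[ℝ] sobolevZero T k :=
  (((WithLp.linearEquiv 2 ℝ (Fin (k + 1) → L2 T)).symm.toLinearMap ∘ₗ
      LinearMap.pi fun m => testL2 ℝ T ∘ₗ testDeriv ℝ _ ^ (m : ℕ)).codRestrict (sobolev T k)
    fun φ m => isWeakDeriv_testL2 m φ).codRestrict (sobolevZero T k)
    fun φ => Submodule.le_topologicalClosure _ ⟨φ, isTest_coe φ, coeFn_testL2 φ⟩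

/-- The weak derivative of order `m` as a continuous linear map `H^k_0(0,T) → L²(0,T)`. -/
def wderivL (T : ℝ) {k : ℕ} (m : Fin (k + 1)) : sobolevZero T k →L[ℝ] L2 T :=
  PiLp.proj 2 (fun _ : Fin (k + 1) => L2 T) m ∘L (sobolev T k).subtypeL
    ∘L (sobolevZero T k).subtypeL

theorem wderivL_apply (m : Fin (k + 1)) (u : sobolevZero T k) : wderivL T m u = wderiv u m := rfl

theorem wderivL_embed (m : Fin (k + 1)) (φ : 𝓓(interval T, ℝ)) :
    wderivL T m (embed T k φ) = testL2 ℝ T ((testDeriv ℝ _ ^ (m : ℕ)) φ) := rfl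

theorem toFn_embed (φ : 𝓓(interval T, ℝ)) : toFn (embed T k φ) = testL2 ℝ T φ := rfl

theorem norm_sq_eq_sum_wderivL (u : sobolevZero T k) : ‖u‖ ^ 2 = ∑ m, ‖wderivL T m u‖ ^ 2 :=
  PiLp.norm_sq_eq_of_L2 _ u.1.1

theorem normZero_eq (m : Fin (k + 1)) (u : sobolevZero T k) : normZero m u = ‖wderivL T m u‖ := by
  have h : ‖wderivL T m u‖ ^ 2 = ∫ t in Ioo 0 T, wderiv u m t ^ 2 := by
    rw [← real_inner_self_eq_norm_sq, L2.inner_def]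
    simp [sq, wderivL_apply]
  rw [normZero, ← h, Real.sqrt_sq (norm_nonneg _)]

theorem isClosed_sobolev (T : ℝ) (k : ℕ) :
    IsClosed (sobolev T k : Set (PiLp 2 fun _ : Fin (k + 1) => L2 T)) := by
  have hiff : (sobolev T k : Set (PiLp 2 fun _ : Fin (k + 1) => L2 T))
      = ⋂ (m : Fin (k + 1)) (φ : 𝓓(interval T, ℝ)),
        {U | inner ℝ (testL2 ℝ T ((testDeriv ℝ _ ^ (m : ℕ)) φ)) (U 0)
          = (-1) ^ (m : ℕ) * inner ℝ (testL2 ℝ T φ) (U m)} := by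
    ext U
    simp only [mem_iInter, mem_ofPred_eq, ← isWeakDeriv_iff]
    rfl
  rw [hiff]
  exact isClosed_iInter fun m => isClosed_iInter fun φ => isClosed_eq (by fun_prop) (by fun_prop)

instance (T : ℝ) (k : ℕ) : CompleteSpace (sobolevZero T k) :=
  have : CompleteSpace (sobolev T k) := (isClosed_sobolev T k).completeSpace_coe
  (Submodule.isClosed_topologicalClosure _).completeSpace_coe

theorem memLp_restrict (T : ℝ) (ψ : C(ℝ, ℂ)) : MemLp ψ 2 (volume.restrict (Ioo 0 T)) := by
  obtain ⟨M, hM⟩ := (isCompact_Icc (a := 0) (b := T)).exists_bound_of_continuousOn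
    ψ.continuous.continuousOn
  refine MemLp.of_bound ψ.continuous.aestronglyMeasurable M ?_
  filter_upwards [ae_restrict_mem measurableSet_Ioo] with t ht
  exact hM t (Ioo_subset_Icc_self ht)

/-- The functional `u ↦ ∫₀ᵀ u ψ` on the real space `L²(0,T)`, for a complex `ψ`. -/
def moment (T : ℝ) (ψ : C(ℝ, ℂ)) : L2 T →L[ℝ] ℂ :=
  (innerSL ℂ (memLp_restrict T (star ψ)).toLp).restrictScalars ℝ ∘L
    Complex.ofRealCLM.compLpL 2 (volume.restrict (Ioo 0 T))

theorem moment_apply (ψ : C(ℝ, ℂ)) (u : L2 T) :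
    moment T ψ u = ∫ t in Ioo 0 T, (u t : ℂ) * ψ t := by
  refine (L2.inner_def _ _).trans (integral_congr_ae ?_)
  filter_upwards [(memLp_restrict T (star ψ)).coeFn_toLp,
    Complex.ofRealCLM.coeFn_compLpL (p := 2) u] with t ht ht'
  exact (congrArg₂ (inner ℂ) ht ht').trans (by simp)

theorem moment_star (ψ : C(ℝ, ℂ)) (u : L2 T) : moment T (star ψ) u = star (moment T ψ u) := by
  simp only [moment_apply]
  refine Eq.trans ?_ integral_conj
  simp

theorem moment_testL2_reTest (ψ : C(ℝ, ℂ)) (h : 𝓓(interval T, ℂ)) :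
    moment T ψ (testL2 ℝ T (reTest _ h))
      = (testMoment _ ψ h + star (testMoment _ (star ψ) h)) / 2 := by
  have hconj : Integrable fun t => star (h t * star ψ t) :=
    Complex.conjCLE.toContinuousLinearMap.integrable_comp
      (integrable_test_mul h (star ψ).continuous)
  have hstar : star (∫ t, h t * star ψ t) = ∫ t, star (h t * star ψ t) := integral_conj.symm
  simp only [testMoment_apply]
  rw [hstar, ← integral_add (integrable_test_mul h ψ.continuous) hconj, ← integral_div,
    moment_apply, ← setIntegral_test_mul h fun t ht => by simp [ht]]
  refine integral_congr_ae ?_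
  filter_upwards [coeFn_testL2 (reTest _ h)] with t ht
  simp only [ht, reTest_apply, Complex.re_eq_add_conj, ContinuousMap.star_apply, star_mul',
    Complex.star_def, Complex.conj_conj]
  ring

end Sobolev

/-! ### Schur's test -/

section Schur

variable {ι 𝕜 : Type*} [RCLike 𝕜]

theorem memℓp_two_iff {x : ι → 𝕜} : Memℓp x 2 ↔ Summable fun j => ‖x j‖ ^ 2 := by
  rw [memℓp_gen_iff (by simp)]
  simp

theorem norm_sq_eq_tsum (x : lp (fun _ : ι => 𝕜) 2) : ‖x‖ ^ 2 = ∑' j, ‖x j‖ ^ 2 := by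
  simpa using lp.norm_rpow_eq_tsum (p := 2) (by simp) x

/-- The hypothesis of Schur's test: the rows and the columns of the matrix `K` have `ℓ¹` norm at
most `A`. -/
structure SchurBound (K : ι → ι → 𝕜) (A : ℝ) : Prop where
  nonneg : 0 ≤ A
  row (s : Finset ι) (l : ι) : ∑ j ∈ s, ‖K l j‖ ≤ A
  col (s : Finset ι) (j : ι) : ∑ l ∈ s, ‖K l j‖ ≤ A

theorem SchurBound.of_norm_le_sub {G : Type*} [AddCommGroup G] {K : G → G → 𝕜} {a : G → ℝ}
    (ha : Summable a) (hK : ∀ l j, ‖K l j‖ ≤ a (l - j)) : SchurBound K (∑' i, a i) := by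
  have ha0 (i : G) : 0 ≤ a i := (norm_nonneg (K i 0)).trans ((hK i 0).trans_eq (by rw [sub_zero]))
  have hsum {f : G → G} (hf : Function.Injective f) (s : Finset G) :
      ∑ j ∈ s, a (f j) ≤ ∑' i, a i := by
    simpa using ha.sum_le_tsum (s.map ⟨f, hf⟩) fun i _ => ha0 i
  exact ⟨tsum_nonneg ha0,
    fun s l => (Finset.sum_le_sum fun j _ => hK l j).trans (hsum sub_right_injective s),
    fun s j => (Finset.sum_le_sum fun l _ => hK l j).trans (hsum sub_left_injective s)⟩

namespace SchurBound

variable {K : ι → ι → 𝕜} {A : ℝ}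

theorem sum_sum_mul_sq_le (hK : SchurBound K A) (s t : Finset ι) (x : ι → ℝ) :
    ∑ l ∈ t, ∑ j ∈ s, ‖K l j‖ * x j ^ 2 ≤ A * ∑ j ∈ s, x j ^ 2 := by
  rw [Finset.sum_comm, Finset.mul_sum]
  refine Finset.sum_le_sum fun j _ => ?_
  rw [← Finset.sum_mul]
  gcongr
  exact hK.col t j

theorem sum_norm_sum_sq_le (hK : SchurBound K A) (s t : Finset ι) (x : ι → 𝕜) :
    ∑ l ∈ t, ‖∑ j ∈ s, K l j * x j‖ ^ 2 ≤ A ^ 2 * ∑ j ∈ s, ‖x j‖ ^ 2 := by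
  have hA := hK.nonneg
  have hrow (l : ι) : ‖∑ j ∈ s, K l j * x j‖ ^ 2 ≤ A * ∑ j ∈ s, ‖K l j‖ * ‖x j‖ ^ 2 := by
    calc ‖∑ j ∈ s, K l j * x j‖ ^ 2 ≤ (∑ j ∈ s, ‖K l j * x j‖) ^ 2 := by
          gcongr; exact norm_sum_le _ _
      _ ≤ (∑ j ∈ s, ‖K l j‖) * ∑ j ∈ s, ‖K l j‖ * ‖x j‖ ^ 2 :=
          Finset.sum_sq_le_sum_mul_sum_of_sq_le_mul s (fun j _ => norm_nonneg _)
            (fun j _ => by positivity) fun j _ => by rw [norm_mul]; exact le_of_eq (by ring)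
      _ ≤ _ := by gcongr; exact hK.row s l
  calc _ ≤ ∑ l ∈ t, A * ∑ j ∈ s, ‖K l j‖ * ‖x j‖ ^ 2 := Finset.sum_le_sum fun l _ => hrow l
    _ ≤ A * (A * ∑ j ∈ s, ‖x j‖ ^ 2) := by
        rw [← Finset.mul_sum]
        gcongr
        exact hK.sum_sum_mul_sq_le s t fun j => ‖x j‖
    _ = _ := by ring

theorem summable_row (hK : SchurBound K A) (x : lp (fun _ : ι => 𝕜) 2) (l : ι) :
    Summable fun j => K l j * x j := by
  have hl : Summable fun j => ‖K l j‖ :=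
    summable_of_sum_le (fun _ => norm_nonneg _) fun s => hK.row s l
  refine .of_norm_bounded (hl.mul_right ‖x‖) fun j => ?_
  rw [norm_mul]
  gcongr
  exact lp.norm_apply_le_norm (by simp) x j

theorem sum_norm_tsum_sq_le (hK : SchurBound K A) (x : lp (fun _ : ι => 𝕜) 2) (t : Finset ι) :
    ∑ l ∈ t, ‖∑' j, K l j * x j‖ ^ 2 ≤ (A * ‖x‖) ^ 2 := by
  have hlim : Tendsto (fun s : Finset ι => ∑ l ∈ t, ‖∑ j ∈ s, K l j * x j‖ ^ 2) atTop
      (𝓝 (∑ l ∈ t, ‖∑' j, K l j * x j‖ ^ 2)) :=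
    tendsto_finsetSum _ fun l _ => (hK.summable_row x l).hasSum.norm.pow 2
  refine le_of_tendsto' hlim fun s => (hK.sum_norm_sum_sq_le s t x).trans ?_
  rw [mul_pow, norm_sq_eq_tsum]
  gcongr
  exact (memℓp_two_iff.1 x.2).sum_le_tsum s fun _ _ => sq_nonneg _

/-- The operator on `ℓ²` with matrix `K`. -/
def op (hK : SchurBound K A) : lp (fun _ : ι => 𝕜) 2 →L[𝕜] lp (fun _ : ι => 𝕜) 2 :=
  LinearMap.mkContinuous
    { toFun := fun x => ⟨fun l => ∑' j, K l j * x j,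
        memℓp_two_iff.2 (summable_of_sum_le (fun _ => sq_nonneg _) (hK.sum_norm_tsum_sq_le x))⟩
      map_add' := fun x y => by
        ext l
        simp only [lp.coeFn_add, Pi.add_apply, mul_add]
        exact (hK.summable_row x l).tsum_add (hK.summable_row y l)
      map_smul' := fun c x => by
        ext l
        simp only [lp.coeFn_smul, Pi.smul_apply, smul_eq_mul, RingHom.id_apply, mul_left_comm,
          tsum_mul_left] }
    A fun x => by
      refine (sq_le_sq₀ (norm_nonneg _) (mul_nonneg hK.nonneg (norm_nonneg _))).1 ?_
      rw [norm_sq_eq_tsum]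
      exact Real.tsum_le_of_sum_le (fun _ => sq_nonneg _) (hK.sum_norm_tsum_sq_le x)

theorem op_apply (hK : SchurBound K A) (x : lp (fun _ : ι => 𝕜) 2) (l : ι) :
    hK.op x l = ∑' j, K l j * x j := rfl

theorem norm_op_le (hK : SchurBound K A) : ‖hK.op‖ ≤ A :=
  LinearMap.mkContinuous_norm_le _ hK.nonneg _

theorem exists_add_op_eq (hK : SchurBound K A) (hA : A < 1) :
    ∃ R : lp (fun _ : ι => 𝕜) 2 →ₗ[𝕜] lp (fun _ : ι => 𝕜) 2, ∀ b, R b + hK.op (R b) = b := by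
  obtain ⟨u, hu⟩ := isUnit_one_sub_of_norm_lt_one (x := -hK.op)
    (by rw [norm_neg]; exact hK.norm_op_le.trans_lt hA)
  refine ⟨(↑u⁻¹ : lp (fun _ : ι => 𝕜) 2 →L[𝕜] lp (fun _ : ι => 𝕜) 2).toLinearMap, fun b => ?_⟩
  simpa [hu] using congrArg (fun F : lp (fun _ : ι => 𝕜) 2 →L[𝕜] lp (fun _ : ι => 𝕜) 2 => F b)
    u.mul_inv

theorem norm_le_two_mul_norm_add_op (hK : SchurBound K A) (hA : A ≤ 1 / 2)
    (x : lp (fun _ : ι => 𝕜) 2) : ‖x‖ ≤ 2 * ‖x + hK.op x‖ := by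
  have hop : ‖hK.op x‖ ≤ 1 / 2 * ‖x‖ := hK.op.le_of_opNorm_le (hK.norm_op_le.trans hA) x
  have htri := norm_sub_le (x + hK.op x) (hK.op x)
  rw [add_sub_cancel_right] at htri
  linarith

theorem norm_sum_smul_sq_le {E : Type*} [NormedAddCommGroup E] [InnerProductSpace 𝕜 E] {v : ι → E}
    (hv : SchurBound (fun l j => inner 𝕜 (v l) (v j)) A) (s : Finset ι) (c : ι → 𝕜) :
    ‖∑ j ∈ s, c j • v j‖ ^ 2 ≤ A * ∑ j ∈ s, ‖c j‖ ^ 2 := by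
  set K : ι → ι → ℝ := fun l j => ‖inner 𝕜 (v l) (v j)‖
  have hsymm (l j : ι) : K l j = K j l := norm_inner_symm _ _
  have hsum := hv.sum_sum_mul_sq_le s s fun j => ‖c j‖
  calc ‖∑ j ∈ s, c j • v j‖ ^ 2
      ≤ ‖inner 𝕜 (∑ j ∈ s, c j • v j) (∑ j ∈ s, c j • v j)‖ := by
        simp [inner_self_eq_norm_sq_to_K]
    _ ≤ ∑ l ∈ s, ∑ j ∈ s, ‖c l‖ * ‖c j‖ * K l j := by
        rw [sum_inner]
        refine norm_sum_le_of_le _ fun l _ => ?_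
        rw [inner_sum]
        refine norm_sum_le_of_le _ fun j _ => ?_
        simp only [inner_smul_left, inner_smul_right, norm_mul, RCLike.norm_conj]
        exact le_of_eq (by ring)
    _ ≤ ∑ l ∈ s, ∑ j ∈ s, (K l j * ‖c j‖ ^ 2 + K j l * ‖c l‖ ^ 2) / 2 := by
        refine Finset.sum_le_sum fun l _ => Finset.sum_le_sum fun j _ => ?_
        rw [← hsymm l j]
        nlinarith [mul_nonneg (norm_nonneg (inner 𝕜 (v l) (v j))) (sq_nonneg (‖c l‖ - ‖c j‖))]
    _ = ∑ l ∈ s, ∑ j ∈ s, K l j * ‖c j‖ ^ 2 := by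
        simp only [← Finset.sum_div, Finset.sum_add_distrib]
        rw [Finset.sum_comm (f := fun l j => K j l * ‖c l‖ ^ 2), add_self_div_two]
    _ ≤ _ := hsum

end SchurBound

theorem summable_of_norm_sum_sq_le {E : Type*} [NormedAddCommGroup E] [CompleteSpace E]
    {f : ι → E} {a : ι → ℝ} {C : ℝ} (ha : Summable a)
    (h : ∀ s : Finset ι, ‖∑ j ∈ s, f j‖ ^ 2 ≤ C * ∑ j ∈ s, a j) : Summable f := by
  refine summable_iff_vanishing_norm.2 fun ε hε => ?_
  obtain ⟨s, hs⟩ := summable_iff_vanishing_norm.1 (ha.mul_left C) (ε ^ 2) (by positivity)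
  refine ⟨s, fun t ht => lt_of_pow_lt_pow_left₀ 2 hε.le ((h t).trans_lt ?_)⟩
  rw [Finset.mul_sum]
  exact (le_abs_self _).trans_lt (hs t ht)

/-- The summable sequence `(1 + |i|)⁻²` on `ℤ`, with which the entries of matrices are compared in
Schur's test. -/
def decay (i : ℤ) : ℝ := 1 / (1 + |(i : ℝ)|) ^ 2

theorem summable_decay : Summable decay := by
  have hnat : Summable fun n : ℕ => 1 / (1 + (n : ℝ)) ^ 2 := by
    refine ((summable_nat_add_iff 1).2
      (Real.summable_one_div_nat_pow.2 one_lt_two)).congr fun n => ?_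
    rw [Nat.cast_add_one, add_comm]
  refine .of_nat_of_neg ?_ ?_ <;> simpa [decay] using hnat

end Schur

/-! ### Superpositions of waves with separated frequencies -/

section Synthesis

/-- The frequencies `x j` are in the same order of magnitude apart as the integers: the distance
between `x l` and `x j` is at least `γ |l - j|`. -/
def IsSeparated (γ : ℝ) (x : ℤ → ℝ) : Prop := ∀ l j : ℤ, γ * |((l - j : ℤ) : ℝ)| ≤ |x l - x j|

theorem IsSeparated.of_add_le {γ : ℝ} {x : ℤ → ℝ} (hx : ∀ j, x j + γ ≤ x (j + 1)) :
    IsSeparated γ x := by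
  have hle {j l : ℤ} (hjl : j ≤ l) : γ * |((l - j : ℤ) : ℝ)| ≤ |x l - x j| := by
    refine le_trans ?_ (le_abs_self _)
    rw [abs_of_nonneg (by exact_mod_cast sub_nonneg.2 hjl)]
    induction l, hjl using Int.leInduction with
    | base => simp
    | succ l _ ih =>
      push_cast at ih ⊢
      linarith [hx l]
  intro l j
  rcases le_total j l with h | h
  · exact hle h
  · rw [← neg_sub j l, Int.cast_neg, abs_neg, abs_sub_comm]
    exact hle h

theorem IsSeparated.mono {γ γ' : ℝ} {x : ℤ → ℝ} (hγ : γ ≤ γ') (hx : IsSeparated γ' x) :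
    IsSeparated γ x :=
  fun l j => (mul_le_mul_of_nonneg_right hγ (abs_nonneg _)).trans (hx l j)

/-- The bracket `⟨ξ⟩ = 1 + |ξ|`. -/
def bracket (ξ : ℝ) : ℝ := 1 + |ξ|

theorem bracket_pos (ξ : ℝ) : 0 < bracket ξ := by unfold bracket; positivity

theorem one_le_bracket (ξ : ℝ) : 1 ≤ bracket ξ := le_add_of_nonneg_right (abs_nonneg ξ)

theorem abs_le_bracket (ξ : ℝ) : |ξ| ≤ bracket ξ := le_add_of_nonneg_left zero_le_one

theorem bracket_div_le (ξ η : ℝ) : bracket ξ / bracket η ≤ bracket (ξ - η) := by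
  rw [div_le_iff₀ (bracket_pos η)]
  have h := abs_sub_abs_le_abs_sub ξ η
  unfold bracket
  nlinarith [mul_nonneg (abs_nonneg (ξ - η)) (abs_nonneg η)]

theorem IsSeparated.one_div_bracket_sq_le {x : ℤ → ℝ} (hx : IsSeparated 1 x) (l j : ℤ) :
    1 / bracket (x l - x j) ^ 2 ≤ decay (l - j) := by
  have h := hx l j
  rw [one_mul] at h
  unfold bracket decay
  gcongr

theorem IsSeparated.one_div_bracket_sq_le_div {γ : ℝ} (hγ : 1 ≤ γ) {x : ℤ → ℝ}
    (hx : IsSeparated γ x) {l j : ℤ} (hlj : l ≠ j) :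
    1 / bracket (x l - x j) ^ 2 ≤ decay (l - j) / γ := by
  have h := hx l j
  have hi : 1 ≤ |((l - j : ℤ) : ℝ)| := by exact_mod_cast Int.one_le_abs (sub_ne_zero.2 hlj)
  set i : ℝ := |((l - j : ℤ) : ℝ)|
  rw [decay, div_div]
  refine one_div_le_one_div_of_le (by positivity) ?_
  calc (1 + i) ^ 2 * γ ≤ (1 + γ * i) ^ 2 := by
        have h1 : 1 ≤ γ * i ^ 2 := one_le_mul_of_one_le_of_one_le hγ (one_le_pow₀ hi)
        linarith [mul_nonneg (sub_nonneg.2 hγ) (sub_nonneg.2 h1)]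
    _ ≤ bracket (x l - x j) ^ 2 := by unfold bracket; gcongr

theorem exists_ft_le_bracket {Ω : Opens ℝ} (h : 𝓓(Ω, ℂ)) (m : ℕ) :
    ∃ A : ℝ, 0 ≤ A ∧ ∀ ξ, bracket ξ ^ m * ‖ft h ξ‖ ≤ A * (1 / bracket ξ ^ 2) := by
  obtain ⟨A, hA, hle⟩ := exists_ft_decay h (m + 2)
  refine ⟨A, hA, fun ξ => ?_⟩
  rw [mul_one_div, le_div_iff₀ (pow_pos (bracket_pos ξ) 2)]
  exact (le_of_eq (by unfold bracket; ring)).trans (hle ξ)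

variable {T : ℝ} {k : ℕ} (ρ : 𝓓(interval T, ℂ))

theorem inner_testL2_modulate (x y : ℝ) :
    inner ℂ (testL2 ℂ T (modulate ρ x)) (testL2 ℂ T (modulate ρ y))
      = ft (normSqTest ρ) (x - y) := by
  rw [inner_testL2_testL2]
  refine integral_congr_ae (ae_of_all _ fun t => ?_)
  have hx : star (expMap (-x) t) = expMap x t := by
    rw [← ContinuousMap.star_apply, star_expMap, neg_neg]
  simp only [modulate_apply, star_mul', hx, sub_eq_add_neg, expMap_add, ContinuousMap.mul_apply]
  change _ = star (ρ t) * ρ t * _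
  ring

theorem exists_schurBound_gram : ∃ A : ℝ, ∀ x, IsSeparated 1 x → SchurBound
    (fun l j => inner ℂ (testL2 ℂ T (modulate ρ (x l))) (testL2 ℂ T (modulate ρ (x j)))) A := by
  obtain ⟨A, hA, hle⟩ := exists_ft_le_bracket (normSqTest ρ) 0
  refine ⟨_, fun x hx => SchurBound.of_norm_le_sub (summable_decay.mul_left A) fun l j => ?_⟩
  rw [inner_testL2_modulate, ← one_mul ‖_‖, ← pow_zero (bracket (x l - x j))]
  exact (hle _).trans (by gcongr; exact hx.one_div_bracket_sq_le l j)

theorem testDeriv_sum_smul_modulate {Ω : Opens ℝ} (ρ : 𝓓(Ω, ℂ)) (s : Finset ℤ) (c : ℤ → ℂ)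
    (x : ℤ → ℝ) :
    testDeriv ℂ Ω (∑ j ∈ s, c j • modulate ρ (x j))
      = ∑ j ∈ s, c j • modulate (testDeriv ℂ Ω ρ) (x j)
        - ∑ j ∈ s, (c j * (Complex.I * x j)) • modulate ρ (x j) := by
  simp only [map_sum, map_smul, testDeriv_modulate, smul_sub, smul_smul, Finset.sum_sub_distrib]

theorem sum_sq_bracket_pow_mul_le_succ (m : ℕ) (s : Finset ℤ) (c : ℤ → ℂ) (x : ℤ → ℝ) :
    ∑ j ∈ s, (bracket (x j) ^ m * ‖c j‖) ^ 2
      ≤ ∑ j ∈ s, (bracket (x j) ^ (m + 1) * ‖c j‖) ^ 2 := by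
  have hb (j : ℤ) : 0 < bracket (x j) := bracket_pos _
  gcongr with j
  · exact mul_nonneg (pow_nonneg (hb j).le _) (norm_nonneg _)
  · exact one_le_bracket _
  · exact m.le_succ

theorem sum_sq_bracket_pow_mul_freq_le (m : ℕ) (s : Finset ℤ) (c : ℤ → ℂ) (x : ℤ → ℝ) :
    ∑ j ∈ s, (bracket (x j) ^ m * ‖c j * (Complex.I * x j)‖) ^ 2
      ≤ ∑ j ∈ s, (bracket (x j) ^ (m + 1) * ‖c j‖) ^ 2 := by
  refine Finset.sum_le_sum fun j _ => ?_
  have hb : 0 ≤ bracket (x j) ^ m := pow_nonneg (bracket_pos _).le _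
  rw [norm_mul, norm_mul, Complex.norm_I, one_mul, Complex.norm_real, Real.norm_eq_abs,
    mul_comm ‖c j‖, ← mul_assoc, pow_succ (bracket (x j))]
  refine pow_le_pow_left₀ (mul_nonneg (mul_nonneg hb (abs_nonneg _)) (norm_nonneg _)) ?_ 2
  exact mul_le_mul_of_nonneg_right (mul_le_mul_of_nonneg_left (abs_le_bracket _) hb)
    (norm_nonneg _)

theorem exists_norm_deriv_sum_modulate_le (m : ℕ) : ∃ A : ℝ, 0 ≤ A ∧ ∀ x, IsSeparated 1 x →
    ∀ (s : Finset ℤ) (c : ℤ → ℂ),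
      ‖testL2 ℂ T ((testDeriv ℂ _ ^ m) (∑ j ∈ s, c j • modulate ρ (x j)))‖ ^ 2
        ≤ A * ∑ j ∈ s, (bracket (x j) ^ m * ‖c j‖) ^ 2 := by
  induction m generalizing ρ with
  | zero =>
    obtain ⟨A, hA⟩ := exists_schurBound_gram ρ
    refine ⟨max A 0, le_max_right _ _, fun x hx s c => ?_⟩
    have hle := (hA x hx).norm_sum_smul_sq_le s c
    simp only [pow_zero, Module.End.one_apply, map_sum, map_smul, one_mul]
    exact hle.trans (by gcongr; exact le_max_left _ _)
  | succ m ih =>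
    obtain ⟨A, hA0, hA⟩ := ih (testDeriv ℂ _ ρ)
    obtain ⟨B, hB0, hB⟩ := ih ρ
    refine ⟨2 * A + 2 * B, by positivity, fun x hx s c => ?_⟩
    rw [pow_succ (testDeriv ℂ _), Module.End.mul_apply, testDeriv_sum_smul_modulate, map_sub,
      map_sub]
    calc _ ≤ 2 * (_ ^ 2 + _ ^ 2) := (pow_le_pow_left₀ (norm_nonneg _) (norm_sub_le _ _) 2).trans
          add_sq_le
      _ ≤ 2 * (A * ∑ j ∈ s, (bracket (x j) ^ (m + 1) * ‖c j‖) ^ 2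
          + B * ∑ j ∈ s, (bracket (x j) ^ (m + 1) * ‖c j‖) ^ 2) := by
          gcongr
          · exact (hA x hx s c).trans
              (mul_le_mul_of_nonneg_left (sum_sq_bracket_pow_mul_le_succ m s c x) hA0)
          · exact (hB x hx s _).trans
              (mul_le_mul_of_nonneg_left (sum_sq_bracket_pow_mul_freq_le m s c x) hB0)
      _ = _ := by ring

/-- The wave `t ↦ Re (c ρ(t) e^{-iξt}) / ⟨ξ⟩ᵏ` of frequency `ξ` and amplitude `c`, whose norm in
`H^k_0(0,T)` is at most of order `‖c‖`. -/
def wave (k : ℕ) (ξ : ℝ) : ℂ →ₗ[ℝ] sobolevZero T k :=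
  embed T k ∘ₗ reTest _ ∘ₗ
    (LinearMap.toSpanSingleton ℂ _ (((bracket ξ : ℂ) ^ k)⁻¹ • modulate ρ ξ)).restrictScalars ℝ

theorem wave_apply (ξ : ℝ) (c : ℂ) :
    wave ρ k ξ c = embed T k (reTest _ ((c * ((bracket ξ : ℂ) ^ k)⁻¹) • modulate ρ ξ)) := by
  rw [mul_smul]
  rfl

theorem moment_wave_sub (y ξ : ℝ) (c : ℂ) :
    moment T (expMap y) (toFn (wave ρ k ξ c))
        - Complex.I * moment T (expMap y) (toFn (wave ρ k ξ (Complex.I * c)))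
      = ft ρ (y - ξ) * ((bracket ξ : ℂ) ^ k)⁻¹ * c := by
  simp only [wave_apply, toFn_embed, moment_testL2_reTest, map_smul, smul_eq_mul, star_mul',
    Complex.star_def, Complex.conj_I]
  have hft : testMoment _ (expMap y) (modulate ρ ξ) = ft ρ (y - ξ) := ft_modulate ρ ξ y
  rw [hft]
  generalize starRingEnd ℂ (testMoment _ (star (expMap y)) (modulate ρ ξ)) = r
  linear_combination (starRingEnd ℂ c * starRingEnd ℂ ((bracket ξ : ℂ) ^ k)⁻¹ * r
    - ft ρ (y - ξ) * ((bracket ξ : ℂ) ^ k)⁻¹ * c) / 2 * Complex.I_sq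

end Synthesis

section Solver

variable {T : ℝ} {k : ℕ} (ρ : 𝓓(interval T, ℂ))

theorem exists_norm_wderivL_sum_wave_le (m : Fin (k + 1)) : ∃ A : ℝ, 0 ≤ A ∧
    ∀ x, IsSeparated 1 x → ∀ (s : Finset ℤ) (b : ℤ → ℂ),
      ‖wderivL T m (∑ j ∈ s, wave ρ k (x j) (b j))‖ ^ 2
        ≤ A * ∑ j ∈ s, (bracket (x j) ^ (m : ℕ) / bracket (x j) ^ k * ‖b j‖) ^ 2 := by
  obtain ⟨A, hA0, hA⟩ := exists_norm_deriv_sum_modulate_le ρ m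
  refine ⟨A, hA0, fun x hx s b => ?_⟩
  have hsum := hA x hx s fun j => b j * ((bracket (x j) : ℂ) ^ k)⁻¹
  have hterm (j : ℤ) : bracket (x j) ^ (m : ℕ) * ‖b j * ((bracket (x j) : ℂ) ^ k)⁻¹‖
      = bracket (x j) ^ (m : ℕ) / bracket (x j) ^ k * ‖b j‖ := by
    rw [norm_mul, norm_inv, norm_pow, Complex.norm_real, Real.norm_of_nonneg (bracket_pos _).le]
    ring
  simp only [hterm] at hsum
  refine le_trans ?_ hsum
  simp only [wave_apply, ← map_sum]
  rw [wderivL_embed, testDeriv_pow_reTest]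
  gcongr
  exact norm_testL2_reTest_le _

theorem bracket_pow_div_nonneg (ξ : ℝ) (m k : ℕ) : 0 ≤ bracket ξ ^ m / bracket ξ ^ k :=
  div_nonneg (pow_nonneg (bracket_pos ξ).le _) (pow_nonneg (bracket_pos ξ).le _)

theorem bracket_pow_div_le_one (ξ : ℝ) {m k : ℕ} (hmk : m ≤ k) :
    bracket ξ ^ m / bracket ξ ^ k ≤ 1 :=
  div_le_one_of_le₀ (pow_le_pow_right₀ (one_le_bracket ξ) hmk) (pow_nonneg (bracket_pos ξ).le _)

theorem summable_bracket_mul_sq (x : ℤ → ℝ) {m : ℕ} (hmk : m ≤ k)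
    (b : lp (fun _ : ℤ => ℂ) 2) :
    Summable fun j => (bracket (x j) ^ m / bracket (x j) ^ k * ‖b j‖) ^ 2 := by
  refine (memℓp_two_iff.1 b.2).of_nonneg_of_le (fun _ => sq_nonneg _) fun j => ?_
  gcongr
  · exact mul_nonneg (bracket_pow_div_nonneg _ _ _) (norm_nonneg _)
  · exact mul_le_of_le_one_left (norm_nonneg _) (bracket_pow_div_le_one _ hmk)

theorem summable_wave {x : ℤ → ℝ} (hx : IsSeparated 1 x) (b : lp (fun _ : ℤ => ℂ) 2) :
    Summable fun j => wave ρ k (x j) (b j) := by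
  choose A _ hA using exists_norm_wderivL_sum_wave_le (k := k) ρ
  have hsummable : Summable fun j =>
      ∑ m : Fin (k + 1), A m * (bracket (x j) ^ (m : ℕ) / bracket (x j) ^ k * ‖b j‖) ^ 2 :=
    summable_sum fun m _ => (summable_bracket_mul_sq x (Nat.le_of_lt_succ m.2) b).mul_left (A m)
  refine summable_of_norm_sum_sq_le hsummable (C := 1) fun s => ?_
  rw [one_mul, Finset.sum_comm]
  refine (norm_sq_eq_sum_wderivL _).trans_le (Finset.sum_le_sum fun m _ => ?_)
  rw [← Finset.mul_sum]
  exact hA m x hx s b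

/-- The superposition `b ↦ ∑ wave (x j) (b j)` of waves of frequencies `x j`. -/
def superpose (k : ℕ) {x : ℤ → ℝ} (hx : IsSeparated 1 x) :
    lp (fun _ : ℤ => ℂ) 2 →ₗ[ℝ] sobolevZero T k where
  toFun b := ∑' j, wave ρ k (x j) (b j)
  map_add' b b' := by
    simp only [lp.coeFn_add, Pi.add_apply, map_add]
    exact (summable_wave ρ hx b).tsum_add (summable_wave ρ hx b')
  map_smul' c b := by
    simp only [lp.coeFn_smul, Pi.smul_apply, map_smul, RingHom.id_apply]
    exact (summable_wave ρ hx b).tsum_const_smul c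

theorem hasSum_wave {x : ℤ → ℝ} (hx : IsSeparated 1 x) (b : lp (fun _ : ℤ => ℂ) 2) :
    HasSum (fun j => wave ρ k (x j) (b j)) (superpose ρ k hx b) :=
  (summable_wave ρ hx b).hasSum

theorem exists_norm_wderivL_superpose_le (m : Fin (k + 1)) : ∃ A : ℝ, 0 ≤ A ∧
    ∀ x (hx : IsSeparated 1 x) (b : lp (fun _ : ℤ => ℂ) 2),
      ‖wderivL T m (superpose ρ k hx b)‖ ^ 2
        ≤ A * ∑' j, (bracket (x j) ^ (m : ℕ) / bracket (x j) ^ k * ‖b j‖) ^ 2 := by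
  obtain ⟨A, hA0, hA⟩ := exists_norm_wderivL_sum_wave_le (k := k) ρ m
  refine ⟨A, hA0, fun x hx b => ?_⟩
  have hlim := ((wderivL T m).continuous.tendsto _).comp (hasSum_wave (k := k) ρ hx b)
  refine le_of_tendsto' (hlim.norm.pow 2) fun s => (hA x hx s b).trans ?_
  gcongr
  exact (summable_bracket_mul_sq x (Nat.le_of_lt_succ m.2) b).sum_le_tsum s fun _ _ => sq_nonneg _

/-- The off-diagonal part of the matrix of interactions between the frequencies `x j`, conjugated by
the weight `⟨x j⟩ᵐ`. -/
def interaction {Ω : Opens ℝ} (ρ : 𝓓(Ω, ℂ)) (x : ℤ → ℝ) (m : ℕ) (l j : ℤ) : ℂ :=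
  if l = j then 0 else (bracket (x l) / bracket (x j) : ℂ) ^ m * ft ρ (x l - x j)

theorem exists_schurBound_interaction {Ω : Opens ℝ} (ρ : 𝓓(Ω, ℂ)) (k : ℕ) :
    ∃ γ : ℝ, 1 ≤ γ ∧ ∀ x, IsSeparated γ x → ∀ m ≤ k, ∃ A ≤ 1 / 2,
      SchurBound (interaction ρ x m) A := by
  obtain ⟨A, hA0, hA⟩ := exists_ft_le_bracket ρ k
  set Z := ∑' i, decay i
  have hZ : 0 ≤ Z := tsum_nonneg fun i => by unfold decay; positivity
  set γ := 1 + 2 * A * Z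
  have hγ : 1 ≤ γ := le_add_of_nonneg_right (by positivity)
  refine ⟨γ, hγ, fun x hx m hmk => ⟨_, ?_, SchurBound.of_norm_le_sub
    (summable_decay.mul_left (A / γ)) fun l j => ?_⟩⟩
  · rw [tsum_mul_left, div_mul_eq_mul_div, div_le_iff₀ (by positivity)]
    linarith
  have hdecay : 0 ≤ A / γ * decay (l - j) := by unfold decay; positivity
  rw [interaction]
  split_ifs with hlj
  · simpa using hdecay
  have hratio : ‖(bracket (x l) / bracket (x j) : ℂ) ^ m‖ ≤ bracket (x l - x j) ^ k := by
    rw [norm_pow, ← Complex.ofReal_div, Complex.norm_real,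
      Real.norm_of_nonneg (div_nonneg (bracket_pos _).le (bracket_pos _).le)]
    exact (pow_le_pow_left₀ (div_nonneg (bracket_pos _).le (bracket_pos _).le)
      (bracket_div_le _ _) m).trans (pow_le_pow_right₀ (one_le_bracket _) hmk)
  calc _ ≤ bracket (x l - x j) ^ k * ‖ft ρ (x l - x j)‖ :=
        (norm_mul _ _).trans_le (mul_le_mul_of_nonneg_right hratio (norm_nonneg _))
    _ ≤ A * (decay (l - j) / γ) := (hA _).trans
        (mul_le_mul_of_nonneg_left (hx.one_div_bracket_sq_le_div hγ hlj) hA0)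
    _ = _ := by ring

theorem hasSum_mul_add_interaction {Ω : Opens ℝ} {ρ : 𝓓(Ω, ℂ)} (hρ : ft ρ 0 = 1) {x : ℤ → ℝ}
    {A : ℝ} (hK : SchurBound (interaction ρ x k) A) (b : lp (fun _ : ℤ => ℂ) 2) (l : ℤ) :
    HasSum (fun j => ft ρ (x l - x j) * ((bracket (x j) : ℂ) ^ k)⁻¹ * b j)
      (((bracket (x l) : ℂ) ^ k)⁻¹ * (b l + hK.op b l)) := by
  have hb (j : ℤ) : (bracket (x j) : ℂ) ≠ 0 := by exact_mod_cast (bracket_pos _).ne'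
  have hoff := (hK.summable_row b l).hasSum
  refine (((hasSum_ite_eq l (b l)).add hoff).mul_left _).congr_fun fun j => ?_
  rw [interaction]
  rcases eq_or_ne l j with rfl | hlj
  · simp only [sub_self, hρ, if_true, zero_mul, add_zero, one_mul]
  · simp only [if_neg hlj, if_neg hlj.symm, zero_add, div_pow]
    field_simp [hb l, hb j]

theorem tsum_bracket_mul_sq_le {Ω : Opens ℝ} {ρ : 𝓓(Ω, ℂ)} {x : ℤ → ℝ} {m : ℕ} (hmk : m ≤ k)
    {A A' : ℝ} (hk : SchurBound (interaction ρ x k) A) (hm : SchurBound (interaction ρ x m) A')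
    (hA' : A' ≤ 1 / 2) (b : lp (fun _ : ℤ => ℂ) 2) :
    ∑' j, (bracket (x j) ^ m / bracket (x j) ^ k * ‖b j‖) ^ 2
      ≤ 4 * ∑' j, (bracket (x j) ^ m / bracket (x j) ^ k * ‖(b + hk.op b) j‖) ^ 2 := by
  set θ : ℤ → ℝ := fun j => bracket (x j) ^ m / bracket (x j) ^ k
  have hnorm (c : ℂ) (j : ℤ) : ‖(θ j : ℂ) * c‖ = θ j * ‖c‖ := by
    rw [norm_mul, Complex.norm_real, Real.norm_of_nonneg (bracket_pow_div_nonneg _ _ _)]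
  let v : lp (fun _ : ℤ => ℂ) 2 := ⟨fun j => θ j * b j, memℓp_two_iff.2 <| by
    simpa only [hnorm] using summable_bracket_mul_sq x hmk b⟩
  have hmul (l j : ℤ) : interaction ρ x m l j * v j = θ l * (interaction ρ x k l j * b j) := by
    have hb (j : ℤ) : (bracket (x j) : ℂ) ≠ 0 := by exact_mod_cast (bracket_pos _).ne'
    change interaction ρ x m l j * (θ j * b j) = _
    unfold interaction
    split_ifs
    · simp
    · simp only [θ, Complex.ofReal_div, Complex.ofReal_pow, div_pow]
      field_simp [hb l, hb j]
  have hv (l : ℤ) : (v + hm.op v) l = θ l * (b + hk.op b) l := by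
    change θ l * b l + hm.op v l = θ l * (b l + hk.op b l)
    simp only [SchurBound.op_apply, hmul, tsum_mul_left, mul_add]
  calc _ = ‖v‖ ^ 2 := by rw [norm_sq_eq_tsum]; simp only [v, hnorm, θ]
    _ ≤ (2 * ‖v + hm.op v‖) ^ 2 := by gcongr; exact hm.norm_le_two_mul_norm_add_op hA' v
    _ = _ := by rw [mul_pow, norm_sq_eq_tsum]; simp only [hv, hnorm, θ]; norm_num

theorem exists_gap_solver {ρ : 𝓓(interval T, ℂ)} (hρ : ft ρ 0 = 1) (k : ℕ) :
    ∃ γ : ℝ, ∃ C : Fin (k + 1) → ℝ, (∀ m, 0 ≤ C m) ∧ ∀ x, IsSeparated γ x →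
      ∃ S : lp (fun _ : ℤ => ℂ) 2 →ₗ[ℝ] sobolevZero T k,
        (∀ B l, moment T (expMap (x l)) (toFn (S B))
            - Complex.I * moment T (expMap (x l)) (toFn (S (Complex.I • B)))
          = ((bracket (x l) : ℂ) ^ k)⁻¹ * B l) ∧
        ∀ m B, ‖wderivL T m (S B)‖ ^ 2
          ≤ C m * ∑' j, (bracket (x j) ^ (m : ℕ) / bracket (x j) ^ k * ‖B j‖) ^ 2 := by
  obtain ⟨γ, hγ, hschur⟩ := exists_schurBound_interaction ρ k
  choose C hC0 hC using exists_norm_wderivL_superpose_le (k := k) ρ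
  refine ⟨γ, fun m => C m * 4, fun m => mul_nonneg (hC0 m) (by norm_num), fun x hx => ?_⟩
  obtain ⟨A, hA, hK⟩ := hschur x hx k le_rfl
  obtain ⟨R, hR⟩ := hK.exists_add_op_eq (hA.trans_lt (by norm_num))
  refine ⟨superpose ρ k (hx.mono hγ) ∘ₗ R.restrictScalars ℝ, fun B l => ?_, fun m B => ?_⟩
  · have hmoment (b : lp (fun _ : ℤ => ℂ) 2) :=
      (((moment T (expMap (x l))) ∘L wderivL T 0).hasSum (hasSum_wave (k := k) ρ (hx.mono hγ) b))
    have hsub := (hmoment (R B)).sub ((hmoment (R (Complex.I • B))).mul_left Complex.I)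
    have hleft := hasSum_mul_add_interaction hρ hK (R B) l
    rw [← Pi.add_apply, ← lp.coeFn_add, hR] at hleft
    refine hsub.unique (hleft.congr_fun fun j => ?_)
    rw [map_smul, ← moment_wave_sub]
    rfl
  · obtain ⟨A', hA', hKm⟩ := hschur x hx m (Nat.le_of_lt_succ m.2)
    refine (hC m x (hx.mono hγ) (R B)).trans ?_
    rw [mul_assoc]
    refine mul_le_mul_of_nonneg_left ?_ (hC0 m)
    simpa only [hR] using tsum_bracket_mul_sq_le (Nat.le_of_lt_succ m.2) hK hKm hA' (R B)

end Solver

/-! ### Test functions orthogonal to high frequencies -/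

section Separation

theorem exists_ft_zero_eq_one {Ω : Opens ℝ} (hΩ : (Ω : Set ℝ).Nonempty) :
    ∃ ρ : 𝓓(Ω, ℂ), ft ρ 0 = 1 := by
  obtain ⟨x, hx⟩ := hΩ
  obtain ⟨ε, hε, hball⟩ := Metric.isOpen_iff.1 Ω.isOpen x hx
  let g : ContDiffBump x := ⟨ε / 4, ε / 2, by positivity, by linarith⟩
  let ρ : 𝓓(Ω, ℝ) := ⟨g.normed volume, g.contDiff_normed, g.hasCompactSupport_normed, by
    rw [g.tsupport_normed_eq]
    exact (Metric.closedBall_subset_ball (half_lt_self hε)).trans hball⟩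
  refine ⟨TestFunction.postcompCLM Complex.ofRealCLM ρ, ?_⟩
  calc _ = ∫ t, (g.normed volume t : ℂ) := integral_congr_ae <| ae_of_all _ fun t => by
        rw [expMap_zero, powMap_apply, pow_zero, mul_one]
        rfl
    _ = 1 := by rw [integral_complex_ofReal, g.integral_normed, Complex.ofReal_one]

theorem expMap_mul_convolution (x : ℝ) (f g : ℝ → ℂ) :
    (fun t => (f ⋆[ContinuousLinearMap.mul ℝ ℂ] g) t * expMap x t)
      = (fun t => f t * expMap x t) ⋆[ContinuousLinearMap.mul ℝ ℂ] fun t => g t * expMap x t := by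
  ext t
  rw [convolution_def, convolution_def, ← integral_mul_const]
  refine integral_congr_ae (ae_of_all _ fun s => ?_)
  have hadd : expMap x t = expMap x s * expMap x (t - s) := by
    rw [expMap_apply, expMap_apply, expMap_apply, ← Complex.exp_add, ← mul_add,
      ← Complex.ofReal_add, add_sub_cancel]
  simp only [ContinuousLinearMap.mul_apply', hadd]
  ring

theorem exists_ft_eq_integral_mul_ft {a b c : ℝ} (habc : a + b ≤ c) {f : ℝ → ℂ}
    (hf : Integrable f) (hsupp : Function.support f ⊆ Icc 0 a) (ρ : 𝓓(interval b, ℂ)) :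
    ∃ h : 𝓓(interval c, ℂ), ∀ x, ft h x = (∫ t, f t * expMap x t) * ft ρ x := by
  set L := ContinuousLinearMap.mul ℝ ℂ
  have hcompact : IsCompact (Icc 0 a + tsupport ρ) := isCompact_Icc.add ρ.hasCompactSupport
  have hsub : Function.support (f ⋆[L] ρ) ⊆ Icc 0 a + tsupport ρ :=
    (support_convolution_subset L).trans (add_subset_add hsupp (subset_tsupport ρ))
  have htsupport : tsupport (f ⋆[L] ρ) ⊆ Ioo 0 c := by
    refine (closure_minimal hsub hcompact.isClosed).trans (add_subset_iff.2 fun s hs t ht => ?_)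
    have ht' : t ∈ Ioo 0 b := ρ.tsupport_subset ht
    exact ⟨add_pos_of_nonneg_of_pos hs.1 ht'.1, (add_lt_add_of_le_of_lt hs.2 ht'.2).trans_le habc⟩
  have hexp (x : ℝ) : Integrable fun t => f t * expMap x t :=
    hf.mul_bdd (expMap x).continuous.aestronglyMeasurable
      (ae_of_all _ fun t => (norm_expMap x t).le)
  refine ⟨⟨f ⋆[L] ρ, ρ.hasCompactSupport.contDiff_convolution_right L hf.locallyIntegrable
    ρ.contDiff, .of_support_subset_isCompact hcompact hsub, htsupport⟩, fun x => ?_⟩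
  calc _ = ∫ t, (f ⋆[L] ρ) t * expMap x t := rfl
    _ = _ := by
      rw [expMap_mul_convolution, integral_convolution _ (hexp x)
        (integrable_test_mul ρ (expMap x).continuous)]
      rfl

/-- The family on `ℤ` with `μ` at `0`, and `lam n` and `-lam n` at `n + 1` and `-(n + 1)`. -/
def symmExt (μ : ℝ) (lam : ℕ → ℝ) : ℤ → ℝ
  | .ofNat 0 => μ
  | .ofNat (n + 1) => lam n
  | .negSucc n => -lam n

theorem isSeparated_symmExt {γ μ : ℝ} {lam : ℕ → ℝ} (hμ : |μ| + γ ≤ lam 0)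
    (hlam : ∀ j, lam j + γ ≤ lam (j + 1)) : IsSeparated γ (symmExt μ lam) := by
  refine .of_add_le fun j => ?_
  match j with
  | .ofNat 0 => exact (add_le_add_left (le_abs_self μ) γ).trans hμ
  | .ofNat (n + 1) => exact hlam n
  | .negSucc 0 =>
    change -lam 0 + γ ≤ μ
    linarith [neg_abs_le μ]
  | .negSucc (n + 1) =>
    change -lam (n + 1) + γ ≤ -lam n
    linarith [hlam n]

theorem exists_integral_expMap_eq_ite {T : ℝ} (hT : 0 < T) : ∃ γ : ℝ, ∀ x, IsSeparated γ x →
    ∃ f : ℝ → ℂ, Integrable f ∧ Function.support f ⊆ Icc 0 T ∧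
      ∀ l, ∫ t, f t * expMap (x l) t = if l = 0 then 1 else 0 := by
  obtain ⟨ρ, hρ⟩ := exists_ft_zero_eq_one (Ω := interval T) (nonempty_Ioo.2 hT)
  obtain ⟨γ, _, _, hsolve⟩ := exists_gap_solver hρ 0
  refine ⟨γ, fun x hx => ?_⟩
  obtain ⟨S, hS, -⟩ := hsolve x hx
  set u := toFn (S (lp.single 2 0 1))
  set v := toFn (S (Complex.I • lp.single 2 0 1))
  have hexp (w : L2 T) (l : ℤ) :
      Integrable (fun t => (w t : ℂ) * expMap (x l) t) (volume.restrict (Ioo 0 T)) :=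
    (Lp.memLp w).ofReal.integrable_mul (memLp_restrict T _)
  have hint (w : L2 T) : Integrable (fun t => (w t : ℂ)) (volume.restrict (Ioo 0 T)) :=
    ((Lp.memLp w).integrable one_le_two).ofReal
  refine ⟨(Ioo 0 T).indicator fun t => u t - Complex.I * v t,
    (integrable_indicator_iff measurableSet_Ioo).2 ((hint u).sub ((hint v).const_mul _)),
    support_indicator_subset.trans Ioo_subset_Icc_self, fun l => ?_⟩
  have hl := hS (lp.single 2 0 1) l
  rw [moment_apply, moment_apply, ← integral_const_mul,
    ← integral_sub (hexp u l) ((hexp v l).const_mul _)] at hl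
  simp only [← indicator_mul_left]
  rw [integral_indicator measurableSet_Ioo]
  refine Eq.trans (integral_congr_ae (ae_of_all _ fun t => ?_)) (hl.trans ?_)
  · ring
  · simp [Pi.single_apply]

theorem exists_ft_separating {T : ℝ} (hT : 0 < T) : ∃ γ : ℝ, ∀ (μ : ℝ) (lam : ℕ → ℝ),
    |μ| + γ ≤ lam 0 → (∀ j, lam j + γ ≤ lam (j + 1)) →
      ∃ h : 𝓓(interval T, ℂ), (∀ j, ft h (lam j) = 0 ∧ ft h (-lam j) = 0) ∧ ft h μ = 1 := by
  obtain ⟨ρ, hρ⟩ := exists_ft_zero_eq_one (Ω := interval (T / 2)) (nonempty_Ioo.2 (half_pos hT))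
  obtain ⟨γ, hγ⟩ := exists_integral_expMap_eq_ite (half_pos hT)
  refine ⟨γ, fun μ lam hμ hlam => ?_⟩
  obtain ⟨f, hf, hsupp, hmoment⟩ := hγ _ (isSeparated_symmExt hμ hlam)
  obtain ⟨h, hh⟩ := exists_ft_eq_integral_mul_ft (add_halves T).le hf hsupp (modulate ρ μ)
  refine ⟨h, fun j => ⟨?_, ?_⟩, ?_⟩
  · have hj := hmoment (.ofNat (j + 1))
    rw [if_neg (by simp; omega)] at hj
    exact (hh _).trans (mul_eq_zero_of_left hj _)
  · have hj := hmoment (.negSucc j)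
    rw [if_neg (by simp)] at hj
    exact (hh _).trans (mul_eq_zero_of_left hj _)
  · have h0 : ∫ t, f t * expMap μ t = 1 := hmoment (.ofNat 0)
    rw [hh, h0, one_mul, ft_modulate, sub_self, hρ]

end Separation

/-! ### Interpolation at finitely many frequencies -/

section Interpolation

variable {Ω : Opens ℝ} {Z : Set ℝ}

/-- The test functions whose Fourier transform vanishes on `Z`. -/
def vanishing (Ω : Opens ℝ) (Z : Set ℝ) : Submodule ℂ 𝓓(Ω, ℂ) :=
  ⨅ x ∈ Z, LinearMap.ker (testMoment Ω (expMap x))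

theorem mem_vanishing {h : 𝓓(Ω, ℂ)} : h ∈ vanishing Ω Z ↔ ∀ x ∈ Z, ft h x = 0 := by
  simp only [vanishing, Submodule.mem_iInf, LinearMap.mem_ker, ft]

theorem testDeriv_pow_mem_vanishing (r : ℕ) {h : 𝓓(Ω, ℂ)} (hh : h ∈ vanishing Ω Z) :
    (testDeriv ℂ Ω ^ r) h ∈ vanishing Ω Z :=
  mem_vanishing.2 fun x hx => by rw [ft_testDeriv_pow, mem_vanishing.1 hh x hx, mul_zero]

theorem exists_mem_vanishing_union {μ : ℝ} {F : Finset ℝ} (hμ : μ ∉ F)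
    (h : ∃ h ∈ vanishing Ω Z, ft h μ ≠ 0) : ∃ g ∈ vanishing Ω (Z ∪ F), ft g μ ≠ 0 := by
  induction F using Finset.induction_on with
  | empty => simpa using h
  | insert ν F _ ih =>
    rw [Finset.mem_insert, not_or] at hμ
    obtain ⟨g, hg, hgμ⟩ := ih hμ.2
    -- The Fourier transform of `(d/dt + iν) g` is that of `g` multiplied by `i (ν - x)`.
    have hft (x : ℝ) : ft (testDeriv ℂ Ω g + (Complex.I * ν) • g) x
        = Complex.I * (ν - x) * ft g x := by
      have hadd : ft (testDeriv ℂ Ω g + (Complex.I * ν) • g) x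
          = ft (testDeriv ℂ Ω g) x + Complex.I * ν * ft g x := by
        simp only [ft, map_add, map_smul, smul_eq_mul]
      rw [hadd, ft_testDeriv]
      ring
    refine ⟨testDeriv ℂ Ω g + (Complex.I * ν) • g, mem_vanishing.2 fun x hx => ?_, ?_⟩
    · rw [hft]
      rcases hx with hx | hx
      · rw [mem_vanishing.1 hg x (.inl hx), mul_zero]
      · rcases Finset.mem_insert.1 hx with rfl | hx
        · rw [sub_self, mul_zero, zero_mul]
        · rw [mem_vanishing.1 hg x (.inr hx), mul_zero]
    · rw [hft]
      refine mul_ne_zero (mul_ne_zero Complex.I_ne_zero (sub_ne_zero.2 ?_)) hgμ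
      exact_mod_cast Ne.symm hμ.1

theorem exists_ft_eq_ite {μ : ℝ} (hμ0 : μ ≠ 0) {F : Finset ℝ} (n : ℕ)
    (h : ∃ h ∈ vanishing Ω Z, ft h μ ≠ 0) :
    ∃ g ∈ vanishing Ω Z, (∀ ν ∈ F, ft g ν = if ν = μ then 1 else 0) ∧
      ∀ p < n, testMoment Ω (powMap p) g = 0 := by
  obtain ⟨g, hg, hgμ⟩ := exists_mem_vanishing_union (F.notMem_erase μ) h
  have hDμ : ft ((testDeriv ℂ Ω ^ n) g) μ ≠ 0 := by
    rw [ft_testDeriv_pow]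
    exact mul_ne_zero (pow_ne_zero _ (neg_ne_zero.2 (mul_ne_zero Complex.I_ne_zero
      (Complex.ofReal_ne_zero.2 hμ0)))) hgμ
  have hD := mem_vanishing.1 (testDeriv_pow_mem_vanishing n hg)
  have hsmul (ν : ℝ) : ft ((ft ((testDeriv ℂ Ω ^ n) g) μ)⁻¹ • (testDeriv ℂ Ω ^ n) g) ν
      = (ft ((testDeriv ℂ Ω ^ n) g) μ)⁻¹ * ft ((testDeriv ℂ Ω ^ n) g) ν :=
    map_smul (testMoment Ω (expMap ν)) _ _
  refine ⟨(ft ((testDeriv ℂ Ω ^ n) g) μ)⁻¹ • (testDeriv ℂ Ω ^ n) g,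
    mem_vanishing.2 fun x hx => ?_, fun ν hν => ?_, fun p hp => ?_⟩
  · rw [hsmul, hD x (.inl hx), mul_zero]
  · rw [hsmul]
    split_ifs with hνμ
    · rw [hνμ, inv_mul_cancel₀ hDμ]
    · rw [hD ν (.inr (Finset.mem_coe.2 (Finset.mem_erase.2 ⟨hνμ, hν⟩))), mul_zero]
  · rw [map_smul, testMoment_powMap_testDeriv_pow, Nat.descFactorial_of_lt hp]
    simp

theorem exists_testMoment_powMap_eq (h : ∃ h ∈ vanishing Ω Z, ft h 0 ≠ 0) (a : ℕ → ℂ) (n : ℕ) :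
    ∃ g ∈ vanishing Ω Z, ∀ p < n, testMoment Ω (powMap p) g = a p := by
  obtain ⟨h, hh, hh0⟩ := h
  rw [ft, expMap_zero] at hh0
  induction n with
  | zero => exact ⟨0, zero_mem _, by simp⟩
  | succ n ih =>
    obtain ⟨g, hg, hga⟩ := ih
    -- The first nonzero moment of `h⁽ⁿ⁾` is that of order `n`.
    have hD := testMoment_powMap_testDeriv_pow (h := h) (q := n)
    have hn : testMoment Ω (powMap n) ((testDeriv ℂ Ω ^ n) h) ≠ 0 := by
      rw [hD, Nat.descFactorial_self, Nat.sub_self]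
      exact mul_ne_zero (mul_ne_zero (pow_ne_zero _ (by norm_num))
        (Nat.cast_ne_zero.2 n.factorial_ne_zero)) hh0
    refine ⟨g + ((a n - testMoment Ω (powMap n) g)
      / testMoment Ω (powMap n) ((testDeriv ℂ Ω ^ n) h)) • (testDeriv ℂ Ω ^ n) h,
      add_mem hg (Submodule.smul_mem _ _ (testDeriv_pow_mem_vanishing n hh)), fun p hp => ?_⟩
    rw [map_add, map_smul, smul_eq_mul]
    rcases Nat.lt_succ_iff_lt_or_eq.1 hp with hp | rfl
    · rw [hga p hp, hD p, Nat.descFactorial_of_lt hp]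
      simp
    · rw [div_mul_cancel₀ _ hn, add_sub_cancel]

theorem exists_ft_eq_and_testMoment_powMap_eq {F : Finset ℝ} (hF : (0 : ℝ) ∉ F)
    (h : ∀ μ ∈ insert 0 F, ∃ h ∈ vanishing Ω Z, ft h μ ≠ 0) (c : ℝ → ℂ) (a : ℕ → ℂ) (n : ℕ) :
    ∃ g ∈ vanishing Ω Z, (∀ ν ∈ F, ft g ν = c ν) ∧ ∀ p < n, testMoment Ω (powMap p) g = a p := by
  obtain ⟨g, hg, hga⟩ := exists_testMoment_powMap_eq
    (exists_mem_vanishing_union hF (h 0 (F.mem_insert_self 0))) a n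
  have hne (μ : F) : (μ : ℝ) ≠ 0 := fun h0 => hF (h0 ▸ μ.2)
  choose e he heF hep using fun μ : F =>
    exists_ft_eq_ite (hne μ) (F := F) n (h μ (Finset.mem_insert_of_mem μ.2))
  refine ⟨g + ∑ μ : F, c μ • e μ,
    add_mem (mem_vanishing.2 fun x hx => mem_vanishing.1 hg x (.inl hx))
      (sum_mem fun μ _ => Submodule.smul_mem _ _ (he μ)), fun ν hν => ?_, fun p hp => ?_⟩
  · have hgν : testMoment Ω (expMap ν) g = 0 := mem_vanishing.1 hg ν (.inr hν)
    have heν (μ : F) : testMoment Ω (expMap ν) (e μ) = if ν = μ then 1 else 0 := heF μ ν hν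
    simp only [ft, map_add, map_sum, map_smul, hgν, heν, smul_eq_mul, mul_ite, mul_one, mul_zero,
      zero_add]
    rw [Finset.sum_coe_sort F fun μ => if ν = μ then c μ else 0, Finset.sum_ite_eq, if_pos hν]
  · simp only [map_add, map_sum, map_smul, hga p hp, hep _ p hp, smul_zero, Finset.sum_const_zero,
      add_zero]

theorem exists_moment_testL2_eq {T : ℝ} (hZ : ∀ x ∈ Z, -x ∈ Z) {F : Finset ℝ}
    (hF : ∀ ν ∈ F, 0 < ν)
    (h : ∀ μ, |μ| ∈ insert 0 F → ∃ h ∈ vanishing (interval T) Z, ft h μ ≠ 0)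
    (c : ℝ → ℂ) (a : ℕ → ℝ) (n : ℕ) :
    ∃ g : 𝓓(interval T, ℝ), (∀ x ∈ Z, moment T (expMap x) (testL2 ℝ T g) = 0) ∧
      (∀ ν ∈ F, moment T (expMap ν) (testL2 ℝ T g) = c ν) ∧
      ∀ p < n, moment T (powMap p) (testL2 ℝ T g) = a p := by
  -- The real part of `g` has the moment `(ĝ(ν) + conj ĝ(-ν)) / 2`, so we ask for `ĝ(-ν) = 0`.
  obtain ⟨g, hg, hgF, hga⟩ := exists_ft_eq_and_testMoment_powMap_eq (F := F ∪ F.image Neg.neg)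
    (fun h0 => by
      rcases Finset.mem_union.1 h0 with h0 | h0
      · exact (hF 0 h0).false
      · obtain ⟨ν, hν, hν0⟩ := Finset.mem_image.1 h0
        exact (hF ν hν).ne' (neg_eq_zero.1 hν0))
    (fun μ hμ => h μ <| by
      rw [Finset.mem_insert, Finset.mem_union, Finset.mem_image] at hμ
      rcases hμ with rfl | hμ | ⟨ν, hν, rfl⟩
      · rw [abs_zero]
        exact F.mem_insert_self 0
      · rw [abs_of_pos (hF μ hμ)]
        exact Finset.mem_insert_of_mem hμ
      · rw [abs_neg, abs_of_pos (hF ν hν)]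
        exact Finset.mem_insert_of_mem hν)
    (fun ν => if 0 < ν then 2 * c ν else 0) (fun p => a p) n
  have hmoment (x : ℝ) : moment T (expMap x) (testL2 ℝ T (reTest _ g))
      = (ft g x + star (ft g (-x))) / 2 := by
    rw [moment_testL2_reTest, star_expMap]
    rfl
  refine ⟨reTest _ g, fun x hx => ?_, fun ν hν => ?_, fun p hp => ?_⟩
  · rw [hmoment, mem_vanishing.1 hg x hx, mem_vanishing.1 hg (-x) (hZ x hx)]
    simp
  · rw [hmoment, hgF ν (Finset.mem_union_left _ hν),
      hgF (-ν) (Finset.mem_union_right _ (Finset.mem_image_of_mem _ hν)), if_pos (hF ν hν),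
      if_neg (by linarith [hF ν hν])]
    simp
  · rw [moment_testL2_reTest, star_powMap, hga p hp]
    simp

theorem exists_mem_vanishing_tail {T : ℝ} (hT : 0 < T) :
    ∃ γ : ℝ, ∀ (ω : ℕ → ℝ) (N : ℕ), (∀ j, N ≤ j → γ ≤ ω (j + 1) - ω j) →
      ∀ μ, |μ| ≤ ω N →
        ∃ h ∈ vanishing (interval T) {x | ∃ j, |x| = ω (N + 1 + j)}, ft h μ ≠ 0 := by
  obtain ⟨γ, hγ⟩ := exists_ft_separating hT
  refine ⟨γ, fun ω N hgap μ hμ => ?_⟩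
  obtain ⟨h, hh, hhμ⟩ := hγ μ (fun j => ω (N + 1 + j)) (by linarith [hgap N le_rfl])
    (fun j => le_sub_iff_add_le'.1 (hgap (N + 1 + j) (by lia)))
  refine ⟨h, mem_vanishing.2 fun x ⟨j, hx⟩ => ?_, hhμ ▸ one_ne_zero⟩
  rcases eq_or_eq_neg_of_abs_eq hx with rfl | rfl
  exacts [(hh j).1, (hh j).2]

theorem exists_moment_testL2_eq_ite {T : ℝ} (hT : 0 < T) :
    ∃ γ : ℝ, ∀ (ω : ℕ → ℝ) (N : ℕ), StrictMono ω → ω 0 = 0 →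
      (∀ j, N ≤ j → γ ≤ ω (j + 1) - ω j) → ∀ (c : ℕ → ℂ) (a : ℕ → ℝ) (n : ℕ),
      ∃ g : 𝓓(interval T, ℝ),
        (∀ j, 0 < j → moment T (expMap (ω j)) (testL2 ℝ T g) = if j ≤ N then c j else 0) ∧
        ∀ p < n, moment T (powMap p) (testL2 ℝ T g) = a p := by
  obtain ⟨γ, hγ⟩ := exists_mem_vanishing_tail hT
  refine ⟨γ, fun ω N hmono hzero hgap c a n => ?_⟩
  have hpos {j : ℕ} (hj : 0 < j) : 0 < ω j := hzero ▸ hmono hj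
  have hnonneg (j : ℕ) : 0 ≤ ω j := hzero ▸ hmono.monotone j.zero_le
  obtain ⟨g, hgZ, hgF, hga⟩ := exists_moment_testL2_eq (T := T)
    (Z := {x | ∃ j, |x| = ω (N + 1 + j)}) (F := (Finset.Icc 1 N).image ω)
    (fun x hx => by simpa only [mem_ofPred_eq, abs_neg] using hx)
    (fun ν hν => by
      obtain ⟨j, hj, rfl⟩ := Finset.mem_image.1 hν
      exact hpos (Finset.mem_Icc.1 hj).1)
    (fun μ hμ => by
      refine hγ ω N hgap μ ?_
      rcases Finset.mem_insert.1 hμ with h0 | hμ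
      · exact h0.trans_le (hnonneg N)
      · obtain ⟨j, hj, h⟩ := Finset.mem_image.1 hμ
        exact h ▸ hmono.monotone (Finset.mem_Icc.1 hj).2)
    (Function.extend ω c 0) a n
  refine ⟨g, fun j hj => ?_, hga⟩
  split_ifs with hjN
  · rw [hgF _ (Finset.mem_image_of_mem ω (Finset.mem_Icc.2 ⟨hj, hjN⟩)),
      hmono.injective.extend_apply]
  · exact hgZ _ ⟨j - (N + 1), by rw [abs_of_nonneg (hnonneg j)]; congr 1; lia⟩

end Interpolation

/-! ### Comparison of the weighted norms -/

section Weights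

variable {ω : ℕ → ℝ} {k m m' : ℕ}

/-- A constant by which the weights of order `m` are bounded by those of order `m + 1`. -/
def weightRatio (ω : ℕ → ℝ) : ℝ := max 2 (ω 1)⁻¹

theorem two_le_weightRatio (ω : ℕ → ℝ) : 2 ≤ weightRatio ω := le_max_left _ _

theorem weightRatio_pow_nonneg (ω : ℕ → ℝ) (m : ℕ) : 0 ≤ weightRatio ω ^ m :=
  pow_nonneg (zero_le_two.trans (two_le_weightRatio ω)) m

theorem one_le_weightRatio_mul_abs_freq (hmono : StrictMono ω) (hzero : ω 0 = 0) {j : ℤ}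
    (hj : j ≠ 0) : 1 ≤ weightRatio ω * |freq ω j| := by
  have hpos : 0 < ω 1 := hzero ▸ hmono one_pos
  have hfreq : ω 1 ≤ |freq ω j| := by
    unfold freq
    split_ifs
    · exact (hmono.monotone (by lia)).trans (le_abs_self _)
    · rw [abs_neg]
      exact (hmono.monotone (by lia)).trans (le_abs_self _)
  calc 1 = (ω 1)⁻¹ * ω 1 := (inv_mul_cancel₀ hpos.ne').symm
    _ ≤ weightRatio ω * |freq ω j| := mul_le_mul (le_max_right _ _) hfreq hpos.le
      (zero_le_two.trans (two_le_weightRatio ω))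

theorem abs_weight_le (hmono : StrictMono ω) (hzero : ω 0 = 0) (j : ℤ) (h : m ≤ m') :
    |weight ω m j| ≤ weightRatio ω ^ (m' - m) * |weight ω m' j| := by
  have hstep (m : ℕ) : |weight ω m j| ≤ weightRatio ω * |weight ω (m + 1) j| := by
    rcases eq_or_ne j 0 with rfl | hj
    · have h2 : |weight ω m 0| ≤ 2 := by
        rcases m.eq_zero_or_pos with rfl | hm
        · norm_num [weight]
        · norm_num [weight, freq, hzero, hm.ne']
      have h1 : |weight ω (m + 1) 0| = 1 := by simp [weight, freq, hzero]
      rw [h1, mul_one]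
      exact h2.trans (two_le_weightRatio ω)
    · simp only [weight, if_neg hj, zero_add, abs_pow]
      calc |freq ω j| ^ m = 1 * |freq ω j| ^ m := (one_mul _).symm
        _ ≤ weightRatio ω * |freq ω j| * |freq ω j| ^ m := by
          gcongr
          exact one_le_weightRatio_mul_abs_freq hmono hzero hj
        _ = _ := by ring
  induction m', h using Nat.le_induction with
  | base => simp
  | succ m' h ih =>
    rw [Nat.succ_sub h, pow_succ, mul_assoc]
    exact ih.trans (mul_le_mul_of_nonneg_left (hstep m') (weightRatio_pow_nonneg ω _))

theorem one_le_weightRatio_pow_mul_abs_weight (hmono : StrictMono ω) (hzero : ω 0 = 0) (m : ℕ)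
    (j : ℤ) : 1 ≤ weightRatio ω ^ m * |weight ω m j| := by
  refine le_trans ?_ (abs_weight_le hmono hzero j m.zero_le)
  unfold weight
  split_ifs <;> norm_num

theorem norm_weighted (ω : ℕ → ℝ) (m : ℕ) (d : ℕ → ℂ) (j : ℕ) :
    ‖weighted ω m d j‖ = |weight ω m j| * ‖d j‖ := by
  rw [weighted, norm_mul, Complex.norm_real, Real.norm_eq_abs]

theorem norm_weighted_le (hmono : StrictMono ω) (hzero : ω 0 = 0) (h : m ≤ m') (d : ℕ → ℂ)
    (j : ℕ) : ‖weighted ω m d j‖ ≤ weightRatio ω ^ (m' - m) * ‖weighted ω m' d j‖ := by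
  rw [norm_weighted, norm_weighted, ← mul_assoc]
  exact mul_le_mul_of_nonneg_right (abs_weight_le hmono hzero j h) (norm_nonneg _)

theorem summable_weighted (hmono : StrictMono ω) (hzero : ω 0 = 0) (hm : m ≤ k) (d : HSeq ω k) :
    Summable fun j => ‖weighted ω m d.term j‖ ^ 2 := by
  refine .of_nonneg_of_le (fun j => sq_nonneg _) (fun j => ?_)
    ((memℓp_two_iff.1 d.2.2.2).mul_left ((weightRatio ω ^ (k - m)) ^ 2))
  rw [← mul_pow]
  exact pow_le_pow_left₀ (norm_nonneg _) (norm_weighted_le hmono hzero hm d.term j) 2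

variable {n : ℕ}

theorem dataNorm_sq (ω : ℕ → ℝ) (m : ℕ) (a : EuclideanSpace ℝ (Fin n)) (d : ℕ → ℂ) :
    dataNorm ω m a d ^ 2 = ∑ i : Fin n, |weight ω m (-(((i : ℕ) : ℤ) + 1)) * a i| ^ 2
      + ∑' j : ℕ, ‖weighted ω m d j‖ ^ 2 :=
  Real.sq_sqrt (by positivity)

theorem sqrt_tsum_norm_weighted_le_dataNorm (ω : ℕ → ℝ) (m : ℕ) (a : EuclideanSpace ℝ (Fin n))
    (d : ℕ → ℂ) : √(∑' j : ℕ, ‖weighted ω m d j‖ ^ 2) ≤ dataNorm ω m a d :=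
  Real.sqrt_le_sqrt (le_add_of_nonneg_left (by positivity))

theorem dataNorm_le (hmono : StrictMono ω) (hzero : ω 0 = 0) (h : m ≤ m') (hm' : m' ≤ k)
    (a : EuclideanSpace ℝ (Fin n)) (d : HSeq ω k) :
    dataNorm ω m a d.term ≤ weightRatio ω ^ (m' - m) * dataNorm ω m' a d.term := by
  have hR := weightRatio_pow_nonneg ω (m' - m)
  refine le_of_sq_le_sq ?_ (mul_nonneg hR (Real.sqrt_nonneg _))
  rw [mul_pow, dataNorm_sq, dataNorm_sq, mul_add, Finset.mul_sum, ← tsum_mul_left]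
  refine add_le_add (Finset.sum_le_sum fun i _ => ?_)
    ((summable_weighted hmono hzero (h.trans hm') d).tsum_le_tsum (fun j => ?_)
      ((summable_weighted hmono hzero hm' d).mul_left _))
  · rw [← mul_pow, abs_mul, abs_mul, ← mul_assoc]
    gcongr
    exact abs_weight_le hmono hzero _ h
  · rw [← mul_pow]
    gcongr
    exact norm_weighted_le hmono hzero h d.term j

theorem abs_le_dataNorm (hmono : StrictMono ω) (hzero : ω 0 = 0) (m : ℕ)
    (a : EuclideanSpace ℝ (Fin n)) (d : ℕ → ℂ) (i : Fin n) :
    |a i| ≤ weightRatio ω ^ m * dataNorm ω m a d := by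
  have hle : |weight ω m (-(((i : ℕ) : ℤ) + 1)) * a i| ≤ dataNorm ω m a d := by
    refine le_of_sq_le_sq ?_ (Real.sqrt_nonneg _)
    rw [dataNorm_sq]
    exact (Finset.single_le_sum
      (f := fun i : Fin n => |weight ω m (-(((i : ℕ) : ℤ) + 1)) * a i| ^ 2)
      (fun i _ => sq_nonneg _) (Finset.mem_univ i)).trans (le_add_of_nonneg_right (by positivity))
  calc |a i| = 1 * |a i| := (one_mul _).symm
    _ ≤ weightRatio ω ^ m * |weight ω m (-(((i : ℕ) : ℤ) + 1))| * |a i| :=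
      mul_le_mul_of_nonneg_right (one_le_weightRatio_pow_mul_abs_weight hmono hzero m _)
        (abs_nonneg _)
    _ ≤ weightRatio ω ^ m * dataNorm ω m a d := by
      rw [mul_assoc, ← abs_mul]
      exact mul_le_mul_of_nonneg_left hle (weightRatio_pow_nonneg ω m)

theorem norm_le_dataNorm (hmono : StrictMono ω) (hzero : ω 0 = 0) (hm : m ≤ k)
    (a : EuclideanSpace ℝ (Fin n)) (d : HSeq ω k) (j : ℕ) :
    ‖d.term j‖ ≤ weightRatio ω ^ m * dataNorm ω m a d.term := by
  have hle : ‖weighted ω m d.term j‖ ≤ dataNorm ω m a d.term :=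
    (Real.le_sqrt_of_sq_le ((summable_weighted hmono hzero hm d).le_tsum j fun _ _ =>
      sq_nonneg _)).trans (sqrt_tsum_norm_weighted_le_dataNorm ω m a d.term)
  calc ‖d.term j‖ = 1 * ‖d.term j‖ := (one_mul _).symm
    _ ≤ weightRatio ω ^ m * |weight ω m j| * ‖d.term j‖ :=
      mul_le_mul_of_nonneg_right (one_le_weightRatio_pow_mul_abs_weight hmono hzero m _)
        (norm_nonneg _)
    _ ≤ weightRatio ω ^ m * dataNorm ω m a d.term := by
      rw [mul_assoc, ← norm_weighted]
      exact mul_le_mul_of_nonneg_left hle (weightRatio_pow_nonneg ω m)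

theorem exists_dataNorm_le_norm (ω : ℕ → ℝ) (k n : ℕ) :
    ∃ D : ℝ, ∀ (a : EuclideanSpace ℝ (Fin n)) (d : HSeq ω k),
      dataNorm ω k a d.term ≤ D * ‖(a, d)‖ := by
  set w : Fin n → ℝ := fun i => weight ω k (-(((i : ℕ) : ℤ) + 1))
  refine ⟨√(∑ i, w i ^ 2 + 1), fun a d => ?_⟩
  have ha : ∑ i, |w i * a i| ^ 2 ≤ (∑ i, w i ^ 2) * ‖(a, d)‖ ^ 2 := by
    rw [Finset.sum_mul]
    refine Finset.sum_le_sum fun i _ => ?_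
    rw [abs_mul, mul_pow, sq_abs]
    gcongr
    exact (PiLp.norm_apply_le a i).trans (norm_fst_le (a, d))
  have hd : ∑' j, ‖weighted ω k d.term j‖ ^ 2 ≤ ‖(a, d)‖ ^ 2 := by
    calc _ = ‖d‖ ^ 2 := (norm_sq_eq_tsum (HSeq.toLp ω k d)).symm
      _ ≤ _ := by
        gcongr
        exact norm_snd_le (a, d)
  refine le_of_sq_le_sq ?_ (by positivity)
  rw [dataNorm_sq, mul_pow, Real.sq_sqrt (by positivity), add_one_mul]
  exact add_le_add ha hd

end Weights

/-! ### The moment problem at high frequencies -/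

section HighFrequencies

variable {T : ℝ} {k : ℕ}

theorem symmExt_neg (lam : ℕ → ℝ) (l : ℤ) : symmExt 0 lam (-l) = -symmExt 0 lam l := by
  rcases l with (_ | n) | n
  · exact neg_zero.symm
  · rfl
  · exact (neg_neg _).symm

/-- The family on `ℤ` with `e n` at `n + 1`, and `0` at the nonpositive integers. -/
def posExt (e : ℕ → ℂ) : ℤ → ℂ
  | .ofNat (n + 1) => e n
  | _ => 0

theorem natCast_add_one_injective : Function.Injective fun n : ℕ => (n + 1 : ℤ) :=
  fun m n h => by simpa using h

theorem posExt_eq_zero (e : ℕ → ℂ) {j : ℤ} (hj : j ∉ range fun n : ℕ => (n + 1 : ℤ)) :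
    posExt e j = 0 := by
  rcases j with (_ | n) | n
  exacts [rfl, absurd ⟨n, rfl⟩ hj, rfl]

theorem tsum_posExt (e : ℕ → ℂ) {f : ℤ → ℂ → ℝ} (hf : ∀ j, f j 0 = 0) :
    ∑' j, f j (posExt e j) = ∑' n : ℕ, f (n + 1) (e n) := by
  refine (natCast_add_one_injective.tsum_eq (f := fun j => f j (posExt e j)) fun j hj => ?_).symm
  by_contra hj'
  exact hj ((congrArg (f j) (posExt_eq_zero e hj')).trans (hf j))

theorem memℓp_posExt {e : ℕ → ℂ} (he : Memℓp e 2) : Memℓp (posExt e) 2 :=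
  memℓp_two_iff.2 <| (natCast_add_one_injective.summable_iff fun j hj => by
    rw [posExt_eq_zero e hj, norm_zero, zero_pow two_ne_zero]).1 (memℓp_two_iff.1 he)

/-- `posExt` as a linear map on `ℓ²`. -/
def posExtLp : lp (fun _ : ℕ => ℂ) 2 →ₗ[ℝ] lp (fun _ : ℤ => ℂ) 2 where
  toFun e := ⟨posExt e, memℓp_posExt (lp.memℓp e)⟩
  map_add' e e' := by
    ext j
    rcases j with (_ | _) | _
    exacts [(add_zero 0).symm, rfl, (add_zero 0).symm]
  map_smul' c e := by
    ext j
    rcases j with (_ | _) | _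
    exacts [(smul_zero c).symm, rfl, (smul_zero c).symm]

theorem exists_odd_gap_solver (hT : 0 < T) (k : ℕ) :
    ∃ γ, ∃ C : Fin (k + 1) → ℝ, (∀ m, 0 ≤ C m) ∧ ∀ x : ℤ → ℝ, (∀ l, x (-l) = -x l) →
      IsSeparated γ x → ∃ S : lp (fun _ : ℤ => ℂ) 2 →ₗ[ℝ] sobolevZero T k,
        (∀ B l, 2 * moment T (expMap (x l)) (toFn (S B))
          = ((bracket (x l) : ℂ) ^ k)⁻¹ * (B l + star (B (-l)))) ∧
        ∀ m B, ‖wderivL T m (S B)‖ ^ 2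
          ≤ C m * ∑' j, (bracket (x j) ^ (m : ℕ) / bracket (x j) ^ k * ‖B j‖) ^ 2 := by
  obtain ⟨ρ, hρ⟩ := exists_ft_zero_eq_one (Ω := interval T) (nonempty_Ioo.2 hT)
  obtain ⟨γ, C, hC, hsolver⟩ := exists_gap_solver hρ k
  refine ⟨γ, C, hC, fun x hodd hx => ?_⟩
  obtain ⟨S, hS, hSm⟩ := hsolver x hx
  refine ⟨S, fun B l => ?_, hSm⟩
  -- Conjugating the identity at `-l` and adding it to the one at `l` eliminates `S (I • B)`.
  have hneg := congrArg star (hS B (-l))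
  rw [hodd, ← star_expMap, moment_star, moment_star] at hneg
  have hbracket : bracket (-x l) = bracket (x l) := by rw [bracket, abs_neg, bracket]
  simp only [hbracket, Complex.star_def, map_sub, map_mul, map_inv₀, map_pow, Complex.conj_conj,
    Complex.conj_I, Complex.conj_ofReal] at hneg
  rw [Complex.star_def]
  linear_combination hS B l + hneg

variable {ω : ℕ → ℝ} {N : ℕ}

theorem bracket_pow_mul_norm_le (m : ℕ) (d : ℕ → ℂ) {j : ℕ} (hj : 1 ≤ ω j) :
    bracket (ω j) ^ m * ‖d j‖ ≤ 2 ^ m * ‖weighted ω m d j‖ := by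
  have hω : 0 ≤ ω j := zero_le_one.trans hj
  have hweight : ω j ^ m ≤ |weight ω m j| := by
    refine le_trans ?_ (le_abs_self _)
    simp only [weight, freq, Int.natCast_nonneg, if_true, Int.toNat_natCast]
    exact le_add_of_nonneg_left (by positivity)
  rw [norm_weighted, ← mul_assoc]
  gcongr
  calc bracket (ω j) ^ m ≤ (2 * ω j) ^ m := by
        gcongr
        · exact (bracket_pos _).le
        · rw [bracket, abs_of_nonneg hω]
          linarith
    _ ≤ 2 ^ m * |weight ω m j| := by
      rw [mul_pow]
      gcongr

theorem sq_bracket_pow_mul_norm_le (m : ℕ) (d : ℕ → ℂ) {j : ℕ} (hj : 1 ≤ ω j) :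
    (bracket (ω j) ^ m * ‖d j‖) ^ 2 ≤ (2 ^ m) ^ 2 * ‖weighted ω m d j‖ ^ 2 := by
  rw [← mul_pow]
  exact pow_le_pow_left₀ (mul_nonneg (pow_nonneg (bracket_pos _).le _) (norm_nonneg _))
    (bracket_pow_mul_norm_le m d hj) 2

theorem summable_sq_bracket_pow_mul_norm (m : ℕ) (hω : ∀ n, 1 ≤ ω (N + 1 + n)) {d : ℕ → ℂ}
    (hd : Summable fun j => ‖weighted ω m d j‖ ^ 2) :
    Summable fun n => (bracket (ω (N + 1 + n)) ^ m * ‖d (N + 1 + n)‖) ^ 2 :=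
  .of_nonneg_of_le (fun _ => sq_nonneg _) (fun n => sq_bracket_pow_mul_norm_le m d (hω n))
    ((hd.comp_injective (add_right_injective (N + 1))).mul_left _)

theorem tsum_sq_bracket_pow_mul_norm_le (m : ℕ) (hω : ∀ n, 1 ≤ ω (N + 1 + n)) {d : ℕ → ℂ}
    (hd : Summable fun j => ‖weighted ω m d j‖ ^ 2) :
    ∑' n, (bracket (ω (N + 1 + n)) ^ m * ‖d (N + 1 + n)‖) ^ 2
      ≤ (2 ^ m) ^ 2 * ∑' j, ‖weighted ω m d j‖ ^ 2 := by
  rw [← tsum_mul_left]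
  exact ((summable_sq_bracket_pow_mul_norm m hω hd).tsum_le_tsum
      (fun n => sq_bracket_pow_mul_norm_le m d (hω n))
      ((hd.comp_injective (add_right_injective (N + 1))).mul_left _)).trans
    (tsum_comp_le_tsum_of_inj (hd.mul_left _) (fun j => by positivity)
      (add_right_injective (N + 1)))

/-- The right-hand side `2 ⟨ω_j⟩^k d_j`, `j > N`, of the system solved at high frequencies. -/
def highData (hω : ∀ n, 1 ≤ ω (N + 1 + n)) (k : ℕ) :
    HSeq ω k →ₗ[ℝ] lp (fun _ : ℤ => ℂ) 2 :=
  posExtLp ∘ₗ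
    { toFun := fun d => ⟨fun n => (2 * bracket (ω (N + 1 + n)) ^ k) • d.term (N + 1 + n), by
        refine memℓp_two_iff.2 (((summable_sq_bracket_pow_mul_norm k hω
          (memℓp_two_iff.1 d.2.2.2)).mul_left (2 ^ 2)).congr fun n => ?_)
        have hb := bracket_pos (ω (N + 1 + n))
        rw [norm_smul, Real.norm_of_nonneg (by positivity), mul_assoc, mul_pow (2 : ℝ)]
        rfl⟩
      map_add' := fun d d' => Subtype.ext <| funext fun n => smul_add _ _ _
      map_smul' := fun c d => Subtype.ext <| funext fun n => smul_comm _ c _ }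

theorem tsum_highData (hω : ∀ n, 1 ≤ ω (N + 1 + n)) (m : ℕ) (d : HSeq ω k) :
    ∑' j, (bracket (symmExt 0 (fun n => ω (N + 1 + n)) j) ^ m
        / bracket (symmExt 0 (fun n => ω (N + 1 + n)) j) ^ k * ‖highData hω k d j‖) ^ 2
      = 2 ^ 2 * ∑' n, (bracket (ω (N + 1 + n)) ^ m * ‖d.term (N + 1 + n)‖) ^ 2 := by
  rw [← tsum_mul_left]
  refine (tsum_posExt _ (f := fun j c => (bracket (symmExt 0 (fun n => ω (N + 1 + n)) j) ^ m
    / bracket (symmExt 0 (fun n => ω (N + 1 + n)) j) ^ k * ‖c‖) ^ 2) fun j => ?_).trans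
    (tsum_congr fun n => ?_)
  · rw [norm_zero, mul_zero, zero_pow two_ne_zero]
  · have hb := bracket_pos (ω (N + 1 + n))
    change (bracket (ω (N + 1 + n)) ^ m / bracket (ω (N + 1 + n)) ^ k
      * ‖(2 * bracket (ω (N + 1 + n)) ^ k) • d.term (N + 1 + n)‖) ^ 2 = _
    rw [norm_smul, Real.norm_of_nonneg (by positivity)]
    field_simp

theorem le_tail_of_gap {γ : ℝ} (hmono : Monotone ω) (hzero : ω 0 = 0)
    (hgap : ∀ j, N ≤ j → γ ≤ ω (j + 1) - ω j) (n : ℕ) : γ ≤ ω (N + 1 + n) := by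
  have hN : ω 0 ≤ ω N := hmono N.zero_le
  have hn : ω (N + 1) ≤ ω (N + 1 + n) := hmono (Nat.le_add_right _ n)
  linarith [hgap N le_rfl]

theorem isSeparated_symmExt_tail {γ : ℝ} (hmono : Monotone ω) (hzero : ω 0 = 0)
    (hgap : ∀ j, N ≤ j → γ ≤ ω (j + 1) - ω j) :
    IsSeparated γ (symmExt 0 fun n => ω (N + 1 + n)) :=
  isSeparated_symmExt
    (by simpa only [abs_zero, zero_add] using le_tail_of_gap hmono hzero hgap 0)
    fun n => le_sub_iff_add_le'.1 (hgap (N + 1 + n) (by lia))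

theorem exists_high_solver (hT : 0 < T) (k : ℕ) :
    ∃ γ : ℝ, ∃ C : Fin (k + 1) → ℝ, (∀ m, 0 ≤ C m) ∧
      ∀ (ω : ℕ → ℝ) (N : ℕ), StrictMono ω → ω 0 = 0 →
      (∀ j, N ≤ j → γ ≤ ω (j + 1) - ω j) → ∃ V : HSeq ω k →ₗ[ℝ] sobolevZero T k,
        (∀ d j, N < j → moment T (expMap (ω j)) (toFn (V d)) = d.term j) ∧
        ∀ m d, ‖wderivL T m (V d)‖ ≤ C m * √(∑' j, ‖weighted ω m d.term j‖ ^ 2) := by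
  obtain ⟨γ, C, hC, hsolver⟩ := exists_odd_gap_solver hT k
  refine ⟨max 1 γ, fun m => √(C m * (2 ^ 2 * (2 ^ (m : ℕ)) ^ 2)),
    fun m => Real.sqrt_nonneg _, fun ω N hmono hzero hgap => ?_⟩
  have hω := le_tail_of_gap hmono.monotone hzero fun j hj => (le_max_left 1 γ).trans (hgap j hj)
  have hsep := isSeparated_symmExt_tail hmono.monotone hzero fun j hj =>
    (le_max_right 1 γ).trans (hgap j hj)
  obtain ⟨S, hS, hSm⟩ := hsolver _ (symmExt_neg _) hsep
  refine ⟨S ∘ₗ highData hω k, fun d j hj => ?_, fun m d => ?_⟩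
  · obtain ⟨n, rfl⟩ := Nat.exists_eq_add_of_le hj
    have hmoment : 2 * moment T (expMap (ω (N + 1 + n))) (toFn (S (highData hω k d)))
        = ((bracket (ω (N + 1 + n)) : ℂ) ^ k)⁻¹
          * ((2 * bracket (ω (N + 1 + n)) ^ k) • d.term (N + 1 + n) + star 0) :=
      hS _ (n + 1 : ℕ)
    have hb : (bracket (ω (N + 1 + n)) : ℂ) ^ k ≠ 0 :=
      pow_ne_zero _ (by exact_mod_cast (bracket_pos _).ne')
    refine mul_left_cancel₀ two_ne_zero (hmoment.trans ?_)
    rw [star_zero, add_zero, Complex.real_smul]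
    push_cast
    field_simp
  · have hCm := hC m
    rw [← Real.sqrt_mul (by positivity)]
    refine Real.le_sqrt_of_sq_le ((hSm m _).trans ?_)
    rw [tsum_highData, mul_assoc, mul_assoc]
    have hle := tsum_sq_bracket_pow_mul_norm_le m hω
      (summable_weighted hmono hzero (Nat.le_of_lt_succ m.2) d)
    gcongr

end HighFrequencies

/-! ### Correction of the low frequencies and of the polynomial moments -/

section LowFrequencies

variable {T : ℝ} {k : ℕ} {ω : ℕ → ℝ} {N n : ℕ}

/-- The moments against `e^{iω_j t}` for `1 ≤ j ≤ N` and against `t^p` for `p < n`. -/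
def lowMoments (T : ℝ) (ω : ℕ → ℝ) (N n : ℕ) :
    L2 T →L[ℝ] (Fin N → ℂ) × (Fin n → ℝ) :=
  (ContinuousLinearMap.pi fun j : Fin N => moment T (expMap (ω (j + 1)))).prod
    (ContinuousLinearMap.pi fun p : Fin n => Complex.reCLM ∘L moment T (powMap p))

theorem moment_powMap (p : ℕ) (u : L2 T) :
    moment T (powMap p) u = ((∫ t in Ioo 0 T, t ^ p * u t : ℝ) : ℂ) := by
  rw [moment_apply, ← integral_complex_ofReal]
  refine integral_congr_ae (ae_of_all _ fun t => ?_)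
  simp [powMap_apply, mul_comm]

theorem exists_low_solver (hT : 0 < T) : ∃ γ : ℝ, ∀ (ω : ℕ → ℝ) (N : ℕ),
    StrictMono ω → ω 0 = 0 → (∀ j, N ≤ j → γ ≤ ω (j + 1) - ω j) → ∀ k n : ℕ,
      ∃ R : (Fin N → ℂ) × (Fin n → ℝ) →L[ℝ] sobolevZero T k,
        (∀ y, lowMoments T ω N n (toFn (R y)) = y) ∧
        ∀ y j, N < j → moment T (expMap (ω j)) (toFn (R y)) = 0 := by
  obtain ⟨γ, hγ⟩ := exists_moment_testL2_eq_ite hT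
  refine ⟨γ, fun ω N hmono hzero hgap k n => ?_⟩
  let K : Submodule ℝ 𝓓(interval T, ℝ) :=
    ⨅ j ∈ Ioi N, LinearMap.ker ((moment T (expMap (ω j))).toLinearMap ∘ₗ testL2 ℝ T)
  have hK {g} : g ∈ K ↔ ∀ j, N < j → moment T (expMap (ω j)) (testL2 ℝ T g) = 0 := by
    simp only [K, Submodule.mem_iInf, LinearMap.mem_ker, mem_Ioi, LinearMap.comp_apply,
      ContinuousLinearMap.coe_coe]
  let f : K →ₗ[ℝ] (Fin N → ℂ) × (Fin n → ℝ) :=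
    (lowMoments T ω N n).toLinearMap ∘ₗ testL2 ℝ T ∘ₗ K.subtype
  have hf : Function.Surjective f := fun ⟨c, a⟩ => by
    obtain ⟨g, hg, hga⟩ := hγ ω N hmono hzero hgap
      (Function.extend (fun j : Fin N => (j + 1 : ℕ)) c 0) (Function.extend Fin.val a 0) n
    have hinj : Function.Injective fun j : Fin N => (j + 1 : ℕ) := fun i j h => by
      simpa [Fin.ext_iff] using h
    refine ⟨⟨g, hK.2 fun j hj => by rw [hg j (by lia), if_neg hj.not_ge]⟩, Prod.ext ?_ ?_⟩
    · ext1 j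
      refine (hg (j + 1) j.val.succ_pos).trans ?_
      rw [if_pos (Nat.succ_le_of_lt j.2), hinj.extend_apply c 0 j]
    · ext1 p
      refine (congrArg Complex.re (hga p p.2)).trans ?_
      rw [Complex.ofReal_re, Fin.val_injective.extend_apply]
  obtain ⟨g, hg⟩ := f.exists_rightInverse_of_surjective (LinearMap.range_eq_top.2 hf)
  refine ⟨(embed T k ∘ₗ K.subtype ∘ₗ g).toContinuousLinearMap, fun y => ?_, fun y j hj => ?_⟩
  · exact LinearMap.congr_fun hg y
  · exact hK.1 (g y).2 j hj

/-- The values prescribed for `lowMoments`. -/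
def lowData (ω : ℕ → ℝ) (k N n : ℕ) :
    EuclideanSpace ℝ (Fin n) × HSeq ω k →ₗ[ℝ] (Fin N → ℂ) × (Fin (n + 1) → ℝ) where
  toFun z := (fun j => z.2.term (j + 1), Fin.cons (z.2.term 0).re z.1)
  map_add' z z' := by
    refine Prod.ext rfl (funext fun p => ?_)
    cases p using Fin.cases <;> rfl
  map_smul' c z := by
    refine Prod.ext rfl (funext fun p => ?_)
    cases p using Fin.cases
    exacts [Complex.smul_re _ _, rfl]

theorem norm_lowData_le (hmono : StrictMono ω) (hzero : ω 0 = 0) {m : ℕ} (hm : m ≤ k)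
    (a : EuclideanSpace ℝ (Fin n)) (d : HSeq ω k) :
    ‖lowData ω k N n (a, d)‖ ≤ weightRatio ω ^ m * dataNorm ω m a d.term := by
  have h0 : 0 ≤ weightRatio ω ^ m * dataNorm ω m a d.term :=
    mul_nonneg (weightRatio_pow_nonneg ω m) (Real.sqrt_nonneg _)
  refine norm_prod_le_iff.2 ⟨(pi_norm_le_iff_of_nonneg h0).2 fun j =>
    norm_le_dataNorm hmono hzero hm a d _, (pi_norm_le_iff_of_nonneg h0).2 fun p => ?_⟩
  cases p using Fin.cases with
  | zero => exact (Complex.abs_re_le_norm _).trans (norm_le_dataNorm hmono hzero hm a d 0)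
  | succ i => exact abs_le_dataNorm hmono hzero m a d.term i

variable (V : HSeq ω k →ₗ[ℝ] sobolevZero T k)
  (R : (Fin N → ℂ) × (Fin (n + 1) → ℝ) →L[ℝ] sobolevZero T k)

/-- The solution of the moment problem that corrects, by means of a solver `R` for the low moments,
the solution `V d` of the problem at high frequencies. -/
def corrected : EuclideanSpace ℝ (Fin n) × HSeq ω k →ₗ[ℝ] sobolevZero T k :=
  V ∘ₗ LinearMap.snd ℝ _ _ + R.toLinearMap ∘ₗ (lowData ω k N n
    - (lowMoments T ω N (n + 1) ∘L wderivL T 0).toLinearMap ∘ₗ V ∘ₗ LinearMap.snd ℝ _ _)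

variable {V R}

theorem corrected_apply (z : EuclideanSpace ℝ (Fin n) × HSeq ω k) : corrected V R z
    = V z.2 + R (lowData ω k N n z - lowMoments T ω N (n + 1) (toFn (V z.2))) := rfl

theorem toFn_add (u v : sobolevZero T k) : toFn (u + v) = toFn u + toFn v := rfl

theorem lowMoments_corrected (hR : ∀ y, lowMoments T ω N (n + 1) (toFn (R y)) = y)
    (z : EuclideanSpace ℝ (Fin n) × HSeq ω k) :
    lowMoments T ω N (n + 1) (toFn (corrected V R z)) = lowData ω k N n z := by
  rw [corrected_apply, toFn_add, map_add, hR, add_sub_cancel]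

theorem moment_corrected
    (hV : ∀ d j, N < j → moment T (expMap (ω j)) (toFn (V d)) = d.term j)
    (hR : ∀ y, lowMoments T ω N (n + 1) (toFn (R y)) = y)
    (hR' : ∀ y j, N < j → moment T (expMap (ω j)) (toFn (R y)) = 0) (hzero : ω 0 = 0)
    (a : EuclideanSpace ℝ (Fin n)) (d : HSeq ω k) (j : ℕ) :
    moment T (expMap (ω j)) (toFn (corrected V R (a, d))) = d.term j := by
  have hlow := lowMoments_corrected (V := V) hR (a, d)
  rcases lt_or_ge N j with hj | hj
  · rw [corrected_apply, toFn_add, map_add, hV _ j hj, hR' _ j hj, add_zero]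
  rcases j with _ | j
  · have hre : (moment T (powMap 0) (toFn (corrected V R (a, d)))).re = (d.term 0).re :=
      congrFun (congrArg Prod.snd hlow) 0
    rw [hzero, expMap_zero]
    refine Complex.ext hre ?_
    rw [moment_powMap, Complex.ofReal_im]
    exact d.2.2.1.symm
  · exact congrFun (congrArg Prod.fst hlow) ⟨j, hj⟩

theorem integral_pow_mul_corrected (hR : ∀ y, lowMoments T ω N (n + 1) (toFn (R y)) = y)
    (a : EuclideanSpace ℝ (Fin n)) (d : HSeq ω k) (i : Fin n) :
    ∫ t in Ioo 0 T, t ^ ((i : ℕ) + 1) * toFn (corrected V R (a, d)) t = a i := by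
  have hre : (moment T (powMap (i + 1)) (toFn (corrected V R (a, d)))).re = a i :=
    congrFun (congrArg Prod.snd (lowMoments_corrected hR (a, d))) i.succ
  rwa [moment_powMap, Complex.ofReal_re] at hre

theorem exists_norm_wderivL_corrected_le (hmono : StrictMono ω) (hzero : ω 0 = 0)
    {C : Fin (k + 1) → ℝ} (hC : ∀ m, 0 ≤ C m)
    (hV : ∀ m d, ‖wderivL T m (V d)‖ ≤ C m * √(∑' j, ‖weighted ω m d.term j‖ ^ 2))
    (m : Fin (k + 1)) :
    ∃ C' : ℝ, ∀ (a : EuclideanSpace ℝ (Fin n)) (d : HSeq ω k),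
      ‖wderivL T m (corrected V R (a, d))‖ ≤ C' * dataNorm ω m a d.term := by
  have hm := Nat.le_of_lt_succ m.2
  set M := lowMoments T ω N (n + 1)
  refine ⟨C m + ‖wderivL T m ∘L R‖ * (weightRatio ω ^ (m : ℕ)
    + ‖M‖ * (C 0 * weightRatio ω ^ (m : ℕ))), fun a d => ?_⟩
  have hV' (m : Fin (k + 1)) : ‖wderivL T m (V d)‖ ≤ C m * dataNorm ω m a d.term :=
    (hV m d).trans (mul_le_mul_of_nonneg_left
      (sqrt_tsum_norm_weighted_le_dataNorm ω m a d.term) (hC m))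
  have hV0 : ‖toFn (V d)‖ ≤ C 0 * (weightRatio ω ^ (m : ℕ) * dataNorm ω m a d.term) :=
    (hV' 0).trans (mul_le_mul_of_nonneg_left (dataNorm_le hmono hzero (Nat.zero_le _) hm a d)
      (hC 0))
  calc ‖wderivL T m (corrected V R (a, d))‖
      = ‖wderivL T m (V d) + (wderivL T m ∘L R) (lowData ω k N n (a, d) - M (toFn (V d)))‖ := by
        rw [corrected_apply, map_add]
        rfl
    _ ≤ ‖wderivL T m (V d)‖
        + ‖wderivL T m ∘L R‖ * (‖lowData ω k N n (a, d)‖ + ‖M‖ * ‖toFn (V d)‖) :=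
      norm_add_le_of_le le_rfl ((ContinuousLinearMap.le_opNorm _ _).trans
        (mul_le_mul_of_nonneg_left (norm_sub_le_of_le le_rfl (M.le_opNorm _)) (norm_nonneg _)))
    _ ≤ C m * dataNorm ω m a d.term + ‖wderivL T m ∘L R‖
        * (weightRatio ω ^ (m : ℕ) * dataNorm ω m a d.term
          + ‖M‖ * (C 0 * (weightRatio ω ^ (m : ℕ) * dataNorm ω m a d.term))) := by
      gcongr
      · exact hV' m
      · exact norm_lowData_le hmono hzero hm a d
    _ = _ := by ring

theorem exists_forall_norm_wderivL_corrected_le (hmono : StrictMono ω) (hzero : ω 0 = 0)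
    {C : Fin (k + 1) → ℝ} (hC : ∀ m, 0 ≤ C m)
    (hV : ∀ m d, ‖wderivL T m (V d)‖ ≤ C m * √(∑' j, ‖weighted ω m d.term j‖ ^ 2)) :
    ∃ C' : ℝ, 0 < C' ∧ ∀ m (a : EuclideanSpace ℝ (Fin n)) (d : HSeq ω k),
      ‖wderivL T m (corrected V R (a, d))‖ ≤ C' * dataNorm ω m a d.term := by
  choose C' hC' using exists_norm_wderivL_corrected_le (n := n) (R := R) hmono hzero hC hV
  obtain ⟨B, hB⟩ := (finite_range C').bddAbove
  exact ⟨max 1 B, lt_max_of_lt_left one_pos, fun m a d => (hC' m a d).trans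
    (mul_le_mul_of_nonneg_right (le_max_of_le_right (hB (mem_range_self m)))
      (Real.sqrt_nonneg _))⟩

theorem exists_norm_le_of_norm_wderivL_le (hmono : StrictMono ω) (hzero : ω 0 = 0)
    {L : EuclideanSpace ℝ (Fin n) × HSeq ω k →ₗ[ℝ] sobolevZero T k} {C : ℝ} (hC : 0 ≤ C)
    (hL : ∀ m a d, ‖wderivL T m (L (a, d))‖ ≤ C * dataNorm ω m a d.term) :
    ∃ D : ℝ, ∀ z, ‖L z‖ ≤ D * ‖z‖ := by
  obtain ⟨D, hD⟩ := exists_dataNorm_le_norm ω k n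
  refine ⟨∑ m : Fin (k + 1), C * weightRatio ω ^ (k - m : ℕ) * D, fun ⟨a, d⟩ => ?_⟩
  have hsum : ‖L (a, d)‖ ≤ ∑ m, ‖wderivL T m (L (a, d))‖ := by
    refine le_of_sq_le_sq ?_ (by positivity)
    rw [norm_sq_eq_sum_wderivL]
    exact Finset.sum_sq_le_sq_sum_of_nonneg fun _ _ => norm_nonneg _
  refine hsum.trans ?_
  rw [Finset.sum_mul]
  refine Finset.sum_le_sum fun m _ => (hL m a d).trans ?_
  calc C * dataNorm ω m a d.term
      ≤ C * (weightRatio ω ^ (k - m : ℕ) * (D * ‖(a, d)‖)) := by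
        refine mul_le_mul_of_nonneg_left ?_ hC
        exact (dataNorm_le hmono hzero (Nat.le_of_lt_succ m.2) le_rfl a d).trans
          (mul_le_mul_of_nonneg_left (hD a d) (weightRatio_pow_nonneg ω _))
    _ = _ := by ring

end LowFrequencies

theorem AsymptGapPoly.tendsto_gap {ω : ℕ → ℝ} (hω : AsymptGapPoly ω) :
    Tendsto (fun j => ω (j + 1) - ω j) atTop atTop := by
  obtain ⟨ε, hε, N, c, hc, hgap⟩ := hω
  exact tendsto_atTop_mono' atTop (eventually_atTop.2 ⟨N, hgap⟩)
    (((tendsto_rpow_atTop hε).comp tendsto_natCast_atTop_atTop).const_mul_atTop hc)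

end TrigMoment

end

open Filter TrigMoment

theorem theorem3p8_general {T : ℝ} (hT : 0 < T) (k : ℕ) :
    ∃ γ : ℝ, ∀ (n : ℕ) (ω : ℕ → ℝ), StrictMono ω → ω 0 = 0 →
      (∀ᶠ j in atTop, γ ≤ ω (j + 1) - ω j) →
      ∃ C : ℝ, 0 < C ∧ ∃ L : (EuclideanSpace ℝ (Fin n) × HSeq ω k) →L[ℝ] sobolevZero T k,
        ∀ (a : EuclideanSpace ℝ (Fin n)) (d : HSeq ω k),
          (∀ j : ℕ, ∫ t in Ioo 0 T, ((toFn (L (a, d)) t : ℝ) : ℂ)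
            * Complex.exp (Complex.I * (ω j : ℂ) * (t : ℂ)) = d.term j) ∧
          (∀ i : Fin n, ∫ t in Ioo 0 T, t ^ ((i : ℕ) + 1) * toFn (L (a, d)) t = a i) ∧
          ∀ m : Fin (k + 1), normZero m (L (a, d)) ≤ C * dataNorm ω (m : ℕ) a d.term := by
  obtain ⟨γ, hlow⟩ := exists_low_solver hT
  obtain ⟨γ', C, hC, hhigh⟩ := exists_high_solver hT k
  refine ⟨max γ γ', fun n ω hmono hzero hgap => ?_⟩
  obtain ⟨N, hN⟩ := eventually_atTop.1 hgap
  obtain ⟨R, hR, hR'⟩ := hlow ω N hmono hzero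
    (fun j hj => (le_max_left γ γ').trans (hN j hj)) k (n + 1)
  obtain ⟨V, hV, hVm⟩ := hhigh ω N hmono hzero fun j hj => (le_max_right γ γ').trans (hN j hj)
  obtain ⟨C', hC', hL⟩ := exists_forall_norm_wderivL_corrected_le (R := R) hmono hzero hC hVm
  obtain ⟨D, hD⟩ := exists_norm_le_of_norm_wderivL_le hmono hzero hC'.le hL
  refine ⟨C', hC', (corrected V R).mkContinuous D hD, fun a d =>
    ⟨fun j => ?_, integral_pow_mul_corrected hR a d, fun m => ?_⟩⟩
  · rw [← moment_corrected hV hR hR' hzero a d j, moment_apply]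
    rfl
  · rw [normZero_eq]
    exact hL m a d

theorem theorem3p8 (T : ℝ) (hT : 0 < T) (k n : ℕ) (hn : 1 ≤ n) (ω : ℕ → ℝ)
    (hmono : StrictMono ω) (hzero : ω 0 = 0) (hgap : TrigMoment.AsymptGapPoly ω) :
    ∃ C : ℝ, 0 < C ∧
      ∃ L : (EuclideanSpace ℝ (Fin n) × TrigMoment.HSeq ω k) →L[ℝ] TrigMoment.sobolevZero T k,
        ∀ (a : EuclideanSpace ℝ (Fin n)) (d : TrigMoment.HSeq ω k),
          (∀ j : ℕ,
            ∫ t in Set.Ioo 0 T, ((TrigMoment.toFn (L (a, d)) t : ℝ) : ℂ)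
              * Complex.exp (Complex.I * (ω j : ℂ) * (t : ℂ)) = d.term j) ∧
          (∀ i : Fin n,
            ∫ t in Set.Ioo 0 T, t ^ ((i : ℕ) + 1) * TrigMoment.toFn (L (a, d)) t = a i) ∧
          (∀ m : Fin (k + 1),
            TrigMoment.normZero m (L (a, d)) ≤ C * TrigMoment.dataNorm ω (m : ℕ) a d.term) := by
  obtain ⟨γ, hγ⟩ := theorem3p8_general hT k
  exact hγ n ω hmono hzero (hgap.tendsto_gap.eventually_ge_atTop γ)
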